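/- **Theorem.** Let $k$ be a perfect field of characteristic $p>0$ and let $R=\bigoplus_{n\ge 0}R_n$ be a reduced, $F$-finite, $\mathbb{N}$-graded Gorenstein ring with $R_0=k$, of Krull dimension $d$. Let $a=a(R)$ be the $a$-invariant of $R$, that is, the largest integer $n$ such that $[H^d_{\mathfrak m}(R)]_n\neq 0$, where $\mathfrak m=\bigoplus_{n>0}R_n$; let $P(R,t)=\sum_{n\ge 0}\dim_k(R_n)\,t^n$ be the Poincaré series and let $e'=\lim_{t\to 1^-}(1-t)^dP(R,t)$ (the integer $a$ and the limit $e'$ exist). For $e\ge 1$ and $q=p^e$ let $R^{(e)}$ be $R$, regarded as an $R$-module through the $e$-th iterate of the Frobenius map, and write $R^{(e)}\cong R^{a_q}\oplus M_q$, where $M_q$ does not have $R$ as a direct summand. Then, for every choice of such decompositions, $$\limsup_{e\to\infty}\frac{a_q}{q^d}\;\le\;\frac{\max(-a,0)^d\,e'}{2^{d-1}\,d!}.$$ In particular, whenever the $F$-signature $s(R)=\lim_{e\to\infty}a_q/q^d$ exists, $$s(R)\le\frac{\max(-a,0)^d\,e'}{2^{d-1}\,d!},$$ which for $a\le 0$ is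 the inequality $s(R)\le\dfrac{(-a)^d\,e'}{2^{d-1}\,d!}$. -/

import Mathlib

open Filter Topology CategoryTheory
open scoped Nat

universe u v

noncomputable section

namespace GradedFSignature

/-! ### Gorenstein rings -/

/-- A commutative ring is Gorenstein if it is Noetherian and each of its localizations at a prime
has finite injective dimension as a module over itself. -/
def IsGorenstein (R : Type u) [CommRing R] : Prop :=
  IsNoetherianRing R ∧ ∀ (P : Ideal R) [P.IsPrime], ∃ n : ℕ,
    HasInjectiveDimensionLE
      (ModuleCat.of (Localization.AtPrime P) (Localization.AtPrime P)) n

/-! ### Frobenius push-forwards, free ranks and the F-signature -/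

/-- The module `R^(e)`: the additive group of `R`, regarded as an `R`-module through the `e`-fold
iterate of the Frobenius endomorphism, `r • x = r ^ (p ^ e) * x`. -/
def FrobeniusModule (R : Type u) (_p _e : ℕ) : Type u := R

instance (R : Type u) [CommRing R] (p e : ℕ) : AddCommGroup (FrobeniusModule R p e) :=
  inferInstanceAs (AddCommGroup R)

instance (R : Type u) [CommRing R] (p e : ℕ) [ExpChar R p] :
    Module R (FrobeniusModule R p e) :=
  Module.compHom R (iterateFrobenius R p e)

/-- `M` has `R` as a direct summand. -/
def HasFreeSummand (R : Type u) [CommRing R] (M : Type v) [AddCommGroup M] [Module R M] : Prop :=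
  ∃ N Q : Submodule R M, IsCompl N Q ∧ Nonempty (N ≃ₗ[R] R)

/-- `M` decomposes as `R ^ n ⊕ Q`, where `Q` does not have `R` as a direct summand. -/
def IsFreeRank (R : Type u) [CommRing R] (M : Type v) [AddCommGroup M] [Module R M]
    (n : ℕ) : Prop :=
  ∃ N Q : Submodule R M, IsCompl N Q ∧ Nonempty (N ≃ₗ[R] (Fin n → R)) ∧ ¬ HasFreeSummand R Q

/-- `c e` is a number `a_q`, `q = p ^ e`, for every positive integer `e`: there is a decomposition
of `R^(e)` as the sum of a free module of rank `c e` and a module without free summands. -/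
def IsFreeRankSequence (R : Type u) [CommRing R] (p : ℕ) [ExpChar R p] (c : ℕ → ℕ) : Prop :=
  ∀ e : ℕ, 0 < e → IsFreeRank R (FrobeniusModule R p e) (c e)

/-- `s` is the F-signature `lim a_q / q ^ d` of the ring `R` of dimension `d`. -/
def IsFSignature (R : Type u) [CommRing R] (p : ℕ) [ExpChar R p] (d : ℕ) (s : ℝ) : Prop :=
  ∃ c : ℕ → ℕ, IsFreeRankSequence R p c ∧
    Tendsto (fun e : ℕ => (c e : ℝ) / ((p : ℝ) ^ e) ^ d) atTop (𝓝 s)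

/-! ### Top local cohomology through the Čech complex -/

section Cech

variable {R : Type u} [CommRing R] {d : ℕ}

theorem isUnit_prod_erase (f : Fin d → R) (i : Fin d) :
    IsUnit (algebraMap R (Localization.Away (∏ j, f j)) (∏ j ∈ Finset.univ.erase i, f j)) := by
  refine isUnit_of_dvd_unit (map_dvd _ ?_)
    (IsLocalization.Away.algebraMap_isUnit (S := Localization.Away (∏ j, f j)) (∏ j, f j))
  exact Finset.prod_dvd_prod_of_subset _ _ _ (Finset.erase_subset _ _)

/-- The natural map from the localization of `R` at the product of the `f j`, `j ≠ i`, to the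
localization of `R` at the product of all `f j`. -/
def cechMap (f : Fin d → R) (i : Fin d) :
    Localization.Away (∏ j ∈ Finset.univ.erase i, f j) →+* Localization.Away (∏ j, f j) :=
  IsLocalization.Away.lift (∏ j ∈ Finset.univ.erase i, f j) (isUnit_prod_erase f i)

/-- The image of the last differential of the Čech complex on `f`. -/
def cechBoundary (f : Fin d → R) : Submodule R (Localization.Away (∏ j, f j)) :=
  ⨆ i, Submodule.span R (Set.range (cechMap f i))

/-- The `d`-th (top) cohomology of the Čech complex on `d` elements `f`. If the `f i` generate an
ideal with radical `𝔪`, it is the local cohomology module `H^d_𝔪(R)`. -/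
abbrev CechTop (f : Fin d → R) : Type u :=
  Localization.Away (∏ j, f j) ⧸ cechBoundary f

end Cech

/-! ### Graded rings: the a-invariant and the Poincaré series -/

section Graded

variable {k : Type v} {R : Type u} [Field k] [CommRing R] [Algebra k R]

/-- The component of degree `n` of the top Čech cohomology on homogeneous elements `f i` of
degrees `b i`: the classes of the fractions `r / (∏ f) ^ N`, where `r` is homogeneous of degree
`n + N * ∑ b`. -/
def cechTopDegree (𝒜 : ℕ → Submodule k R) {d : ℕ} (b : Fin d → ℕ) (f : Fin d → R) (n : ℤ) :
    Submodule k (CechTop f) :=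
  Submodule.span k {x | ∃ (N m : ℕ) (r : R), r ∈ 𝒜 m ∧ (m : ℤ) = n + N * ∑ i, (b i : ℤ) ∧
    x = (cechBoundary f).mkQ
      (Localization.mk r ⟨(∏ j, f j) ^ N, pow_mem (Submonoid.mem_powers _) N⟩)}

/-- `f` is a homogeneous system of parameters with degrees `b` of the graded ring `R`, where
`d` is the dimension of `R`: the `f i` have positive degrees, and `R_+` is contained in the
radical of the ideal that they generate. -/
structure IsHomogeneousParameters (𝒜 : ℕ → Submodule k R) [GradedAlgebra 𝒜] {d : ℕ}
    (b : Fin d → ℕ) (f : Fin d → R) : Prop where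
  dim_eq : ringKrullDim R = d
  pos : ∀ i, 0 < b i
  mem : ∀ i, f i ∈ 𝒜 (b i)
  le_radical : (HomogeneousIdeal.irrelevant 𝒜).toIdeal ≤ (Ideal.span (Set.range f)).radical

/-- `a` is the a-invariant of the graded ring `R` of dimension `d`: the largest degree in which
the local cohomology module `H^d_𝔪(R)`, `𝔪 = R_+`, does not vanish. The graded module
`H^d_𝔪(R)` is computed by the Čech complex on any homogeneous system of parameters. -/
def IsAInvariant (𝒜 : ℕ → Submodule k R) [GradedAlgebra 𝒜] (d : ℕ) (a : ℤ) : Prop :=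
  IsGreatest {n : ℤ | ∃ (b : Fin d → ℕ) (f : Fin d → R),
    IsHomogeneousParameters 𝒜 b f ∧ cechTopDegree 𝒜 b f n ≠ ⊥} a

/-- The Poincaré series `P(R, t)`, the sum of the `dim_k R_n * t ^ n`, at a real number `t`. -/
def poincareSeries (𝒜 : ℕ → Submodule k R) (t : ℝ) : ℝ :=
  ∑' n : ℕ, (Module.finrank k (𝒜 n) : ℝ) * t ^ n

end Graded

end GradedFSignature

end

/-! Choose a homogeneous system of parameters `f` of degrees `b`, put I = (f), and let u be a
homogeneous element of top degree σ that is nonzero in R/I. Write q = p^e, let I^[q] be the ideal of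
the powers f_i^q, and let J = (I^[q] : u^q). If X ∈ R^(e) lies in J, then u • X lies in I R^(e), so
the coordinates of X in a free summand R^c lie in the proper ideal (I : u). Since k is perfect, the
c basis vectors therefore stay k-independent modulo J, whence c ≤ dim_k R/J
(`le_finrank_of_isFreeRank`).

The dimension of R/J is bounded by Gorenstein duality. The quotient R/I^[q] has a one-dimensional
socle, in degree σ' = a + qΣb, while σ = a + Σb. Multiplication into the socle shows that R/J has in
degree n dimension at most dim R_n and at most dim R_{S-n}, where S = σ' - qσ = -(q-1)a, truncated
at 0. Using the first bound below S/2 and the second above it gives dim R/J ≤ 2 Σ_{n ≤ S/2} dim R_n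
(`finite_and_finrank_quotient_colon_le`). This halving is the source of the factor 2^(d-1). With
Σ_{n ≤ N} dim R_n ≤ (e'/d!)(N + Σb)^d, division by q^d and passage to the limit give the theorem.

The algebraic input is extracted from finite injective dimension of the localization at R_+. This
finiteness survives division by a nonzerodivisor (`hasInjectiveDimensionLE_quotient`). A Noetherian
local ring with finite self-injective dimension and nonzero socle is self-injective
(`injective_of_hasInjectiveDimensionLE`), so its maximal ideal is nil and its socle is simple. Hence
a maximal homogeneous regular sequence is a system of parameters, and a dimension count then makes
every homogeneous system of parameters regular. Regularity yields the Hilbert series, and it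
identifies a, the degree of that series as a rational function, with the top nonzero degree of Čech
cohomology. -/

namespace GradedFSignature

/-! ### Injective dimension modulo a nonzerodivisor. -/

section InjectiveDimension

variable {A : Type u} [CommRing A]

/-- The torsion submodule is Hom_A(A/x, N). In Baer's criterion, pull the ideal back to A and extend
there; the pulled-back ideal contains x, which forces the image of 1 to be x-torsion. -/
theorem torsionBy_injective (x : A) (N : Type u) [AddCommGroup N] [Module A N]
    [Module.Injective A N] :
    Module.Injective (A ⧸ Ideal.span {x}) (Submodule.torsionBy A N x) := by
  apply Module.Baer.injective
  intro J g
  let g' : J.comap (Ideal.Quotient.mk (Ideal.span {x})) →ₗ[A] N :=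
    { toFun := fun r => (g ⟨Ideal.Quotient.mk _ r.1, r.2⟩ : N)
      map_add' := fun r s => by
        rw [← Submodule.coe_add, ← map_add]; rfl
      map_smul' := fun r s => by
        have := g.map_smul (Ideal.Quotient.mk _ r) ⟨Ideal.Quotient.mk _ s.1, s.2⟩
        rw [Submodule.torsionBy.mk_smul] at this
        rw [RingHom.id_apply, ← Submodule.coe_smul, ← this]; rfl }
  obtain ⟨h, hh⟩ := (Module.Baer.of_injective ‹Module.Injective A N›) _ g'
  have hmem : x ∈ J.comap (Ideal.Quotient.mk (Ideal.span {x})) := by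
    rw [Ideal.mem_comap, Ideal.Quotient.eq_zero_iff_mem.2 (Ideal.mem_span_singleton_self x)]
    exact J.zero_mem
  have h1 : x • h 1 = 0 := by
    rw [← map_smul, smul_eq_mul, mul_one, hh x hmem]
    have : (⟨Ideal.Quotient.mk (Ideal.span {x}) x, hmem⟩ : J) = 0 := by
      ext
      exact Ideal.Quotient.eq_zero_iff_mem.2 (Ideal.mem_span_singleton_self x)
    change ((g ⟨Ideal.Quotient.mk (Ideal.span {x}) x, hmem⟩ : Submodule.torsionBy A N x) : N) = 0
    rw [this]; simp
  refine ⟨LinearMap.toSpanSingleton _ _ ⟨h 1, h1⟩, fun b hb => ?_⟩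
  obtain ⟨r, rfl⟩ := Ideal.Quotient.mk_surjective b
  have h2 := hh r hb
  rw [LinearMap.toSpanSingleton_apply, Submodule.torsionBy.mk_smul]
  ext
  rw [Submodule.coe_smul, ← map_smul, smul_eq_mul, mul_one, h2]
  rfl

/-- The map induced on `x`-torsion by a linear map. -/
noncomputable def torsionByMap (x : A) {M N : Type u} [AddCommGroup M] [Module A M]
    [AddCommGroup N] [Module A N] (f : M →ₗ[A] N) :
    Submodule.torsionBy A M x →ₗ[A ⧸ Ideal.span {x}] Submodule.torsionBy A N x where
  toFun m := ⟨f m.1, by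
    have : x • m.1 = 0 := m.2
    change x • f m.1 = 0
    rw [← map_smul, this, map_zero]⟩
  map_add' m n := by ext; simp
  map_smul' r m := by
    obtain ⟨r, rfl⟩ := Ideal.Quotient.mk_surjective r
    ext
    simp

theorem exists_smul_eq_of_injective {x : A} (hx : x ∈ nonZeroDivisors A) (N : Type u)
    [AddCommGroup N] [Module A N] [Module.Injective A N] (y : N) : ∃ z : N, x • z = y := by
  obtain ⟨h, hh⟩ := Module.Injective.out (LinearMap.mulLeft A x)
    (fun a b hab => by
      simpa using (mul_cancel_left_mem_nonZeroDivisors hx).1 hab)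
    (LinearMap.toSpanSingleton A N y)
  refine ⟨h 1, ?_⟩
  have := hh 1
  simpa [← map_smul] using this

/-- On x-divisible modules taking x-torsion is exact, so it turns an injective coresolution of N
into one of the torsion over A/x. -/
theorem hasInjectiveDimensionLE_torsionBy {x : A} (hxA : x ∈ nonZeroDivisors A) (n : ℕ)
    (N : Type u) [AddCommGroup N]
    [Module A N] (hN : HasInjectiveDimensionLE (ModuleCat.of A N) n)
    (hx : ∀ y : N, ∃ z : N, x • z = y) :
    HasInjectiveDimensionLE
      (ModuleCat.of (A ⧸ Ideal.span {x}) (Submodule.torsionBy A N x)) n := by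
  induction n generalizing N with
  | zero =>
    have h1 : Injective (ModuleCat.of A N) := injective_iff_hasInjectiveDimensionLT_one.2 hN
    have h2 := Module.injective_module_of_injective_object A N
    have h3 := torsionBy_injective x N
    have h4 := Module.injective_object_of_injective_module (A ⧸ Ideal.span {x})
      (Submodule.torsionBy A N x)
    exact injective_iff_hasInjectiveDimensionLT_one.1 h4
  | succ n ih =>
    obtain ⟨I, inj, f, monof⟩ := (inferInstance : EnoughInjectives (ModuleCat.{u} A)).1
      (ModuleCat.of A N)
    have injf : Function.Injective f.hom := (ModuleCat.mono_iff_injective f).mp ‹_›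
    let S : ShortComplex (ModuleCat.{u} A) :=
      ModuleCat.shortComplexOfCompEqZero f.hom f.hom.range.mkQ
        f.hom.exact_map_mkQ_range.linearMap_comp_eq_zero
    have exactS : S.ShortExact := ModuleCat.shortComplex_shortExact S
      f.hom.exact_map_mkQ_range injf (Submodule.mkQ_surjective _)
    have hI : Module.Injective A I := by
      rw [Module.injective_iff_injective_object]; exact inj
    have hdiv := exists_smul_eq_of_injective hxA I
    have hC : HasInjectiveDimensionLE (ModuleCat.of A (I ⧸ f.hom.range)) n :=
      (exactS.hasInjectiveDimensionLT_X₃_iff n inj).2 hN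
    have hCx := ih (I ⧸ f.hom.range) hC (fun y => by
      obtain ⟨y, rfl⟩ := Submodule.Quotient.mk_surjective _ y
      obtain ⟨z, rfl⟩ := hdiv y
      exact ⟨Submodule.Quotient.mk z, rfl⟩)
    have hexact : Function.Exact (torsionByMap x f.hom) (torsionByMap x f.hom.range.mkQ) := by
      rintro ⟨y, hy⟩
      constructor
      · intro h
        have h' : f.hom.range.mkQ y = 0 := congrArg Subtype.val h
        obtain ⟨z, hz⟩ : y ∈ f.hom.range := by simpa using h'
        refine ⟨⟨z, ?_⟩, ?_⟩
        · refine injf ?_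
          rw [LinearMap.map_zero]
          have : x • y = 0 := hy
          rw [← hz, ← map_smul] at this
          exact this
        · ext; exact hz
      · rintro ⟨z, hz⟩
        have hz' : f.hom z.1 = y := congrArg Subtype.val hz
        ext
        change f.hom.range.mkQ y = 0
        rw [← hz']
        simp
    have hinj : Function.Injective (torsionByMap x f.hom) := fun a b hab =>
      Subtype.ext (injf (congrArg Subtype.val hab))
    have hsurj : Function.Surjective (torsionByMap x f.hom.range.mkQ) := by
      rintro ⟨c, hc⟩
      obtain ⟨e, rfl⟩ := Submodule.Quotient.mk_surjective _ c
      have h1 : Submodule.Quotient.mk (p := f.hom.range) (x • e) = 0 := hc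
      rw [Submodule.Quotient.mk_eq_zero] at h1
      obtain ⟨w, hw⟩ := h1
      obtain ⟨z, rfl⟩ := hx w
      refine ⟨⟨e - f.hom z, ?_⟩, ?_⟩
      · change x • (e - f.hom z) = 0
        rw [smul_sub, ← hw, map_smul, sub_self]
      · ext
        change f.hom.range.mkQ (e - f.hom z) = f.hom.range.mkQ e
        simp
    let T : ShortComplex (ModuleCat.{u} (A ⧸ Ideal.span {x})) :=
      ModuleCat.shortComplexOfCompEqZero (torsionByMap x f.hom)
        (torsionByMap x f.hom.range.mkQ) hexact.linearMap_comp_eq_zero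
    have hT : T.ShortExact := ModuleCat.shortComplex_shortExact T hexact hinj hsurj
    have h3 := torsionBy_injective x I
    have h4 := Module.injective_object_of_injective_module (A ⧸ Ideal.span {x})
      (Submodule.torsionBy A I x)
    exact (hT.hasInjectiveDimensionLT_X₃_iff n h4).1 hCx

/-- Embed A in an injective I with cokernel C. Since A has no x-torsion and I = xI, the snake lemma
for multiplication by x gives 0 → I[x] → C[x] → A/x → 0, in which I[x] is injective and C[x] is
controlled by the previous lemma. -/
theorem hasInjectiveDimensionLE_quotient {x : A} (hxA : x ∈ nonZeroDivisors A) (n : ℕ)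
    (hA : HasInjectiveDimensionLE (ModuleCat.of A A) n) :
    HasInjectiveDimensionLE
      (ModuleCat.of (A ⧸ Ideal.span {x}) (A ⧸ Ideal.span {x})) n := by
  obtain ⟨I, inj, f, monof⟩ := (inferInstance : EnoughInjectives (ModuleCat.{u} A)).1
    (ModuleCat.of A A)
  have injf : Function.Injective f.hom := (ModuleCat.mono_iff_injective f).mp ‹_›
  let S : ShortComplex (ModuleCat.{u} A) :=
    ModuleCat.shortComplexOfCompEqZero f.hom f.hom.range.mkQ
      f.hom.exact_map_mkQ_range.linearMap_comp_eq_zero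
  have exactS : S.ShortExact := ModuleCat.shortComplex_shortExact S
    f.hom.exact_map_mkQ_range injf (Submodule.mkQ_surjective _)
  have hI : Module.Injective A I := by
    rw [Module.injective_iff_injective_object]; exact inj
  have hdiv := exists_smul_eq_of_injective hxA I
  have hC : HasInjectiveDimensionLE (ModuleCat.of A (I ⧸ f.hom.range)) n := by
    -- Weakening to n + 1 makes the dimension shift available also for n = 0; nothing is lost in the
    -- final bound.
    have : HasInjectiveDimensionLE (ModuleCat.of A A) (n + 1) :=
      hasInjectiveDimensionLT_of_ge _ (n + 1) _ (by lia)
    exact (exactS.hasInjectiveDimensionLT_X₃_iff n inj).2 this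
  have hCx := hasInjectiveDimensionLE_torsionBy hxA n (I ⧸ f.hom.range) hC (fun y => by
    obtain ⟨y, rfl⟩ := Submodule.Quotient.mk_surjective _ y
    obtain ⟨z, rfl⟩ := hdiv y
    exact ⟨Submodule.Quotient.mk z, rfl⟩)
  -- The snake connecting map: lift c to e in I and write x e as the image of a; `uniq` shows that a
  -- is well defined modulo x.
  have key : ∀ c : Submodule.torsionBy A (I ⧸ f.hom.range) x,
      ∃ (e : I) (a : A), f.hom.range.mkQ e = c.1 ∧ x • e = f.hom a := by
    rintro ⟨c, hc⟩
    obtain ⟨e, rfl⟩ := Submodule.Quotient.mk_surjective _ c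
    have h1 : Submodule.Quotient.mk (p := f.hom.range) (x • e) = 0 := hc
    rw [Submodule.Quotient.mk_eq_zero] at h1
    obtain ⟨w, hw⟩ := h1
    exact ⟨e, w, rfl, hw.symm⟩
  choose e a he ha using key
  have uniq : ∀ (c : Submodule.torsionBy A (I ⧸ f.hom.range) x) (e' : I) (a' : A),
      f.hom.range.mkQ e' = c.1 → x • e' = f.hom a' →
      Ideal.Quotient.mk (Ideal.span {x}) (a c) = Ideal.Quotient.mk _ a' := by
    intro c e' a' he' ha'
    rw [← he c] at he'
    have h1 : e' - e c ∈ f.hom.range := by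
      rw [← Submodule.ker_mkQ f.hom.range, LinearMap.mem_ker, map_sub, he', sub_self]
    obtain ⟨t, ht⟩ := h1
    rw [Ideal.Quotient.eq, Ideal.mem_span_singleton]
    refine ⟨-t, injf ?_⟩
    have h2 : f.hom (x * -t) = x • f.hom (-t) := by rw [← smul_eq_mul, map_smul]
    rw [map_sub, h2, map_neg, ht, ← ha, ← ha', smul_neg, smul_sub]
    abel
  let g : Submodule.torsionBy A (I ⧸ f.hom.range) x →ₗ[A ⧸ Ideal.span {x}]
      A ⧸ Ideal.span {x} :=
    { toFun := fun c => Ideal.Quotient.mk _ (a c)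
      map_add' := fun c c' => by
        rw [← map_add]
        refine uniq _ (e c + e c') _ ?_ ?_
        · rw [map_add, he, he]; rfl
        · rw [smul_add, ha, ha, map_add]
      map_smul' := fun r c => by
        obtain ⟨r, rfl⟩ := Ideal.Quotient.mk_surjective r
        rw [RingHom.id_apply, smul_eq_mul, ← map_mul]
        refine uniq _ (r • e c) _ ?_ ?_
        · rw [map_smul, he, Submodule.torsionBy.mk_smul]; rfl
        · rw [smul_comm, ha, ← map_smul]; rfl }
  have gapp : ∀ c e' a', f.hom.range.mkQ e' = c.1 → x • e' = f.hom a' →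
      g c = Ideal.Quotient.mk _ a' := uniq
  have hsurj : Function.Surjective g := by
    intro b
    obtain ⟨b, rfl⟩ := Ideal.Quotient.mk_surjective b
    obtain ⟨z, hz⟩ := hdiv (f.hom b)
    refine ⟨⟨f.hom.range.mkQ z, ?_⟩, gapp _ z b rfl hz⟩
    change x • f.hom.range.mkQ z = 0
    rw [← map_smul, hz]
    simp
  have hker : ∀ c, g c = 0 → ∃ z ∈ Submodule.torsionBy A I x, f.hom.range.mkQ z = c.1 := by
    intro c hc
    have h1 : Ideal.Quotient.mk (Ideal.span {x}) (a c) = 0 := hc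
    rw [Ideal.Quotient.eq_zero_iff_mem, Ideal.mem_span_singleton] at h1
    obtain ⟨t, ht⟩ := h1
    refine ⟨e c - f.hom t, ?_, ?_⟩
    · change x • (e c - f.hom t) = 0
      rw [smul_sub, ha, ht, ← smul_eq_mul, map_smul, sub_self]
    · rw [map_sub, he]
      simp
  have hexact : Function.Exact (torsionByMap x f.hom.range.mkQ) g := by
    intro c
    constructor
    · intro h
      obtain ⟨z, hz, hz'⟩ := hker c h
      exact ⟨⟨z, hz⟩, Subtype.ext hz'⟩
    · rintro ⟨z, rfl⟩
      rw [gapp _ z.1 0 rfl, map_zero]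
      rw [map_zero]
      exact z.2
  have hinj : Function.Injective (torsionByMap x f.hom.range.mkQ) := by
    rw [injective_iff_map_eq_zero]
    rintro ⟨y, hy⟩ h
    have h' : f.hom.range.mkQ y = 0 := congrArg Subtype.val h
    obtain ⟨z, hz⟩ : y ∈ f.hom.range := by simpa using h'
    have hy' : x • y = 0 := hy
    have hz0 : z = 0 := by
      rw [← hz, ← map_smul, smul_eq_mul] at hy'
      have h0 : x * z = 0 := injf (by rw [hy', map_zero])
      exact (mul_left_mem_nonZeroDivisors_eq_zero_iff hxA).1 h0
    ext
    change y = 0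
    rw [← hz, hz0, map_zero]
  let T : ShortComplex (ModuleCat.{u} (A ⧸ Ideal.span {x})) :=
    ModuleCat.shortComplexOfCompEqZero (torsionByMap x f.hom.range.mkQ) g
      hexact.linearMap_comp_eq_zero
  have hT : T.ShortExact := ModuleCat.shortComplex_shortExact T hexact hinj hsurj
  have h3 := torsionBy_injective x I
  have h4 : Injective (ModuleCat.of (A ⧸ Ideal.span {x}) (Submodule.torsionBy A I x)) :=
    Module.injective_object_of_injective_module (A ⧸ Ideal.span {x}) (Submodule.torsionBy A I x)
  have h5 : HasInjectiveDimensionLT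
      (ModuleCat.of (A ⧸ Ideal.span {x}) (Submodule.torsionBy A I x)) (n + 2) :=
    hasInjectiveDimensionLT_of_ge _ 1 _ (by lia)
  exact hT.hasInjectiveDimensionLT_X₃ (n + 1) hCx h5

end InjectiveDimension

/-! ### Local rings of finite self-injective dimension with nonzero socle. -/

section SelfInjective

open CategoryTheory.Abelian

variable {B : Type u} [CommRing B]

theorem baer_of_subsingleton_ext (N : ModuleCat.{u} B)
    (h : ∀ J : Ideal B, Subsingleton (Ext (ModuleCat.of B (B ⧸ J)) N 1)) :
    Module.Baer B N := by
  intro J g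
  let S : ShortComplex (ModuleCat.{u} B) :=
    ModuleCat.shortComplexOfCompEqZero J.subtype J.mkQ
      (LinearMap.exact_subtype_mkQ J).linearMap_comp_eq_zero
  have hS : S.ShortExact := ModuleCat.shortComplex_shortExact S
    (LinearMap.exact_subtype_mkQ J) J.injective_subtype (Submodule.mkQ_surjective _)
  have hsub : Subsingleton (Ext S.X₃ N 1) := h J
  let g' : S.X₁ ⟶ N := ModuleCat.ofHom g
  obtain ⟨w, hwf⟩ := Ext.contravariant_sequence_exact₁ hS N
    (Ext.mk₀ g') (zero_add 1) (Subsingleton.elim _ _)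
  obtain ⟨w, rfl⟩ := Ext.homEquiv₀.symm.surjective w
  have h2 : S.f ≫ w = g' := Ext.homEquiv₀.symm.injective (by simpa using hwf)
  refine ⟨w.hom, fun x hx => ?_⟩
  have := congrArg (fun t => t.hom ⟨x, hx⟩) h2
  exact this

/-- Dimension shifting along an embedding into an injective reduces to Baer's criterion. -/
theorem hasInjectiveDimensionLE_of_subsingleton_ext (n : ℕ) (N : ModuleCat.{u} B)
    (h : ∀ J : Ideal B, Subsingleton (Ext (ModuleCat.of B (B ⧸ J)) N (n + 1))) :
    HasInjectiveDimensionLE N n := by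
  induction n generalizing N with
  | zero =>
    have h1 : Module.Injective B N := (baer_of_subsingleton_ext N h).injective
    have h2 : Injective N := Module.injective_object_of_injective_module B N
    exact injective_iff_hasInjectiveDimensionLT_one.1 h2
  | succ n ih =>
    obtain ⟨I, inj, f, monof⟩ := (inferInstance : EnoughInjectives (ModuleCat.{u} B)).1 N
    let S : ShortComplex (ModuleCat.{u} B) := ShortComplex.mk f (Limits.cokernel.π f)
      (Limits.cokernel.condition f)
    have hS : S.ShortExact := { exact := ShortComplex.exact_cokernel f }
    refine (hS.hasInjectiveDimensionLT_X₃_iff n inj).1 (ih _ fun J => ?_)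
    refine ⟨fun a b => ?_⟩
    suffices ∀ a : Ext (ModuleCat.of B (B ⧸ J)) S.X₃ (n + 1), a = 0 from
      (this a).trans (this b).symm
    intro a
    have hJ := h J
    obtain ⟨y, rfl⟩ := Ext.covariant_sequence_exact₃ (ModuleCat.of B (B ⧸ J)) hS a rfl
      (Subsingleton.elim (α := Ext (ModuleCat.of B (B ⧸ J)) N (n + 1 + 1)) _ _)
    have : Injective S.X₂ := inj
    rw [y.eq_zero_of_injective, Ext.zero_comp]

/-- Dévissage along a prime filtration, with Ext^(n+2)(-, B) = 0 known. The residue field embeds in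
B through s, so its Ext^(n+1) is squeezed between Ext^(n+1)(B, B) = 0 and Ext^(n+2) of the cokernel.
For another prime, some x in the maximal ideal is regular on the quotient, hence acts surjectively
on Ext^(n+1), which vanishes by Nakayama. -/
theorem subsingleton_ext_of_isLocalRing [IsLocalRing B] [IsNoetherianRing B] {s : B} (hs : s ≠ 0)
    (hms : ∀ y ∈ IsLocalRing.maximalIdeal B, y * s = 0) (n : ℕ)
    (hB : HasInjectiveDimensionLE (ModuleCat.of B B) (n + 1))
    (M : Type u) [AddCommGroup M] [Module B M] (hM : Module.Finite B M) :
    Subsingleton (Ext (ModuleCat.of B M) (ModuleCat.of B B) (n + 1)) := by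
  have hvan : ∀ (Y : ModuleCat.{u} B) (x : Ext Y (ModuleCat.of B B) (n + 2)), x = 0 :=
    fun Y x => x.eq_zero_of_hasInjectiveDimensionLT (n + 2) le_rfl
  have hsub : ∀ Y : ModuleCat.{u} B, (∀ x : Ext Y (ModuleCat.of B B) (n + 1), x = 0) →
    Subsingleton (Ext Y (ModuleCat.of B B) (n + 1)) :=
    fun Y h => ⟨fun a b => (h a).trans (h b).symm⟩
  induction hM using IsNoetherianRing.induction_on_isQuotientEquivQuotientPrime B with
  | subsingleton N =>
    refine hsub _ fun x => ?_
    have : Limits.IsZero (ModuleCat.of B N) := ModuleCat.isZero_of_subsingleton _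
    rw [← x.mk₀_id_comp, this.eq_of_src (𝟙 _) 0, Ext.mk₀_zero, Ext.zero_comp]
  | quotient N p e =>
    by_cases hp : p.1 = IsLocalRing.maximalIdeal B
    · -- the residue field embeds into `B`
      refine hsub _ fun x => ?_
      have hann : ∀ b : B, b ∈ p.1 → b * s = 0 := fun b hb => hms b (hp ▸ hb)
      let ι : N →ₗ[B] B := (Submodule.liftQ p.1 (LinearMap.toSpanSingleton B B s)
        (fun b hb => by simpa using hann b hb)).comp e.toLinearMap
      have hι : Function.Injective ι := by
        rw [LinearMap.coe_comp]
        refine Function.Injective.comp ?_ e.injective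
        rw [← LinearMap.ker_eq_bot]
        refine Submodule.ker_liftQ_eq_bot _ _ _ fun b hb => ?_
        rw [hp]
        by_contra hb'
        have : IsUnit b := by simpa using hb'
        have h0 : b * s = 0 := by simpa using hb
        exact hs (by simpa [this.mul_right_eq_zero] using h0)
      let S : ShortComplex (ModuleCat.{u} B) :=
        ModuleCat.shortComplexOfCompEqZero ι ι.range.mkQ
          ι.exact_map_mkQ_range.linearMap_comp_eq_zero
      have hS : S.ShortExact := ModuleCat.shortComplex_shortExact S
        ι.exact_map_mkQ_range hι (Submodule.mkQ_surjective _)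
      obtain ⟨y, hy⟩ := Ext.contravariant_sequence_exact₁ hS (ModuleCat.of B B) (n₀ := n + 1) x
        (n₁ := n + 2) (by lia) (hvan _ _)
      have : Projective S.X₂ := (inferInstance : Projective (ModuleCat.of B B))
      rw [← hy, y.eq_zero_of_projective, Ext.comp_zero]
    · obtain ⟨x, hxm, hxp⟩ : ∃ x ∈ IsLocalRing.maximalIdeal B, x ∉ p.1 := by
        by_contra! hcon
        exact hp (le_antisymm (IsLocalRing.le_maximalIdeal p.2.ne_top) hcon)
      have hreg : IsSMulRegular N x := by
        rw [isSMulRegular_iff_right_eq_zero_of_smul]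
        intro y hy
        obtain ⟨b, hb⟩ := Ideal.Quotient.mk_surjective (e y)
        have h1 : x • e y = 0 := by rw [← map_smul, hy, map_zero]
        rw [← hb, ← Ideal.Quotient.mk_eq_mk, ← Submodule.Quotient.mk_smul,
          Submodule.Quotient.mk_eq_zero, smul_eq_mul] at h1
        have h2 : b ∈ p.1 := (p.2.mem_or_mem h1).resolve_left hxp
        rw [Ideal.Quotient.eq_zero_iff_mem.2 h2] at hb
        exact e.map_eq_zero_iff.1 hb.symm
      have hS := hreg.smulShortComplex_shortExact (M := ModuleCat.of B N)
      have hfin : Module.Finite B (Ext (ModuleCat.of B N) (ModuleCat.of B B) (n + 1)) :=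
        ModuleCat.finite_ext B _ _ _
      have hle : (⊤ : Submodule B (Ext (ModuleCat.of B N) (ModuleCat.of B B) (n + 1))) ≤
          Ideal.span {x} • ⊤ := by
        intro z _
        obtain ⟨y, hy⟩ := Ext.contravariant_sequence_exact₁ hS (ModuleCat.of B B) (n₀ := n + 1) z (n₁ := n + 2)
          (by lia) (hvan _ _)
        have hy' : z = x • y := by
          have h1 : ∀ y : Ext (ModuleCat.of B N) (ModuleCat.of B B) (n + 1),
              (Ext.mk₀ (x • 𝟙 (ModuleCat.of B N))).comp y (zero_add (n + 1)) = x • y := fun y => by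
            rw [Ext.mk₀_smul, Ext.smul_comp, Ext.mk₀_id_comp]
          exact hy.symm.trans (h1 y)
        rw [hy']
        exact Submodule.smul_mem_smul (Ideal.mem_span_singleton_self x) trivial
      have := Submodule.eq_bot_of_le_smul_of_le_jacobson_bot _ _ hfin.fg_top hle
        (by
          rw [IsLocalRing.jacobson_eq_maximalIdeal _ bot_ne_top]
          simpa [Ideal.span_singleton_le_iff_mem] using hxm)
      exact hsub _ fun z => by
        have hz : z ∈ (⊤ : Submodule B (Ext (ModuleCat.of B N) (ModuleCat.of B B) (n + 1))) :=
          trivial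
        rw [this] at hz
        simpa using hz
  | exact N₁ N₂ N₃ f g hf hg hfg h₁ h₃ =>
    refine hsub _ fun x => ?_
    let S : ShortComplex (ModuleCat.{u} B) :=
      ModuleCat.shortComplexOfCompEqZero f g hfg.linearMap_comp_eq_zero
    have hS : S.ShortExact := ModuleCat.shortComplex_shortExact S hfg hf hg
    obtain ⟨y, hy⟩ := Ext.contravariant_sequence_exact₂ hS (ModuleCat.of B B) x
      (Subsingleton.elim (α := Ext (ModuleCat.of B N₁) (ModuleCat.of B B) (n + 1)) _ _)
    rw [← hy, Subsingleton.elim (α := Ext (ModuleCat.of B N₃) (ModuleCat.of B B) (n + 1)) y 0,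
      Ext.comp_zero]

theorem injective_of_hasInjectiveDimensionLE [IsLocalRing B] [IsNoetherianRing B] {s : B}
    (hs : s ≠ 0) (hms : ∀ y ∈ IsLocalRing.maximalIdeal B, y * s = 0) (n : ℕ)
    (hB : HasInjectiveDimensionLE (ModuleCat.of B B) n) : Module.Injective B B := by
  induction n with
  | zero =>
    have h1 : Injective (ModuleCat.of B B) := injective_iff_hasInjectiveDimensionLT_one.2 hB
    exact Module.injective_module_of_injective_object B B
  | succ n ih =>
    exact ih (hasInjectiveDimensionLE_of_subsingleton_ext n _ fun J =>
      subsingleton_ext_of_isLocalRing hs hms n hB (B ⧸ J) inferInstance)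

/-- The hypothesis makes y u ↦ y v well defined on the ideal (u); its extension to B is
multiplication by some c. -/
theorem exists_mul_eq_of_injective [Module.Injective B B] {u v : B}
    (h : ∀ y, y * u = 0 → y * v = 0) : ∃ c, v = c * u := by
  have hle : LinearMap.ker (LinearMap.toSpanSingleton B B u) ≤
      LinearMap.ker (LinearMap.toSpanSingleton B B v) := fun y hy => by
    simpa using h y (by simpa using hy)
  let f := Submodule.liftQ _ (LinearMap.toSpanSingleton B B u) le_rfl
  have hf : Function.Injective f := by
    rw [← LinearMap.ker_eq_bot]
    exact Submodule.ker_liftQ_eq_bot _ _ _ le_rfl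
  obtain ⟨g, hg⟩ := Module.Injective.out f hf (Submodule.liftQ _ _ hle)
  refine ⟨g 1, ?_⟩
  have h1 := hg (Submodule.Quotient.mk 1)
  simp only [f, Submodule.liftQ_apply, LinearMap.toSpanSingleton_apply, one_smul] at h1
  rw [← h1, mul_comm, ← smul_eq_mul, ← map_smul, smul_eq_mul, mul_one]

/-- The annihilators of the powers of x stabilize, so x^n = c x^(n+1) by the previous lemma, and 1 -
c x is a unit. -/
theorem isNilpotent_of_injective [IsLocalRing B] [IsNoetherianRing B] [Module.Injective B B]
    {x : B} (hx : x ∈ IsLocalRing.maximalIdeal B) : IsNilpotent x := by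
  obtain ⟨n, hn⟩ := monotone_stabilizes_iff_noetherian.2 (inferInstance : IsNoetherian B B)
    ⟨fun n => LinearMap.ker (LinearMap.toSpanSingleton B B (x ^ n)),
      monotone_nat_of_le_succ fun n y hy => by
        have : y * x ^ n = 0 := by simpa using hy
        simp [pow_succ, ← mul_assoc, this]⟩
  obtain ⟨c, hc⟩ := exists_mul_eq_of_injective (u := x ^ (n + 1)) (v := x ^ n) fun y hy => by
    have h1 : y ∈ LinearMap.ker (LinearMap.toSpanSingleton B B (x ^ (n + 1))) := by simpa using hy
    have h2 := hn (n + 1) (Nat.le_succ n)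
    simp only [OrderHom.coe_mk] at h2
    rw [← h2] at h1
    simpa using h1
  refine ⟨n, ?_⟩
  have hunit : IsUnit (1 - c * x) := by
    by_contra h
    have h1 : 1 - c * x ∈ IsLocalRing.maximalIdeal B := h
    have h2 := Ideal.add_mem _ h1 (Ideal.mul_mem_left _ c hx)
    rw [sub_add_cancel] at h2
    exact (Ideal.ne_top_iff_one _).1 (IsLocalRing.maximalIdeal.isMaximal B).ne_top h2
  have h0 : (1 - c * x) * x ^ n = 0 := by
    rw [sub_mul, one_mul, mul_assoc, ← pow_succ', ← hc, sub_self]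
  exact hunit.mul_right_eq_zero.1 h0

end SelfInjective

/-! ### Graded rings: the irrelevant ideal, prime avoidance, finiteness. -/

section GradedRing

variable {k : Type v} {R : Type u} [Field k] [CommRing R] [Algebra k R]
variable (𝒜 : ℕ → Submodule k R) [GradedAlgebra 𝒜]

/-- The irrelevant ideal, as an ideal. -/
abbrev irr : Ideal R := (HomogeneousIdeal.irrelevant 𝒜).toIdeal

theorem mem_irr_iff {r : R} : r ∈ irr 𝒜 ↔ (DirectSum.decompose 𝒜 r 0 : R) = 0 := Iff.rfl

theorem mem_irr_of_mem {n : ℕ} (hn : 0 < n) {r : R} (hr : r ∈ 𝒜 n) : r ∈ irr 𝒜 :=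
  HomogeneousIdeal.mem_irrelevant_of_mem 𝒜 hn hr

theorem exists_sub_mem_irr (hzero : 𝒜 0 = 1) (r : R) : ∃ c : k, r - algebraMap k R c ∈ irr 𝒜 := by
  have h : (DirectSum.decompose 𝒜 r 0 : R) ∈ (1 : Submodule k R) := hzero ▸ (SetLike.coe_mem _)
  obtain ⟨c, hc⟩ := Submodule.mem_one.1 h
  refine ⟨c, ?_⟩
  rw [mem_irr_iff, hc, DirectSum.decompose_sub, DirectSum.sub_apply, AddSubgroupClass.coe_sub,
    DirectSum.decompose_of_mem_same 𝒜 (SetLike.coe_mem (DirectSum.decompose 𝒜 r 0)), sub_self]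

theorem one_notMem_irr [Nontrivial R] : (1 : R) ∉ irr 𝒜 := by
  rw [mem_irr_iff, DirectSum.decompose_of_mem_same 𝒜 SetLike.GradedOne.one_mem]
  exact one_ne_zero

theorem irr_isMaximal [Nontrivial R] (hzero : 𝒜 0 = 1) : (irr 𝒜).IsMaximal := by
  rw [Ideal.isMaximal_iff]
  refine ⟨one_notMem_irr 𝒜, fun J x hJ hx hxJ => ?_⟩
  obtain ⟨c, hc⟩ := exists_sub_mem_irr 𝒜 hzero x
  have hc0 : c ≠ 0 := by
    rintro rfl
    exact hx (by simpa using hc)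
  have h1 : algebraMap k R c ∈ J := by
    have := J.sub_mem hxJ (hJ hc)
    rwa [sub_sub_cancel] at this
  have h2 := J.mul_mem_left (algebraMap k R c⁻¹) h1
  rwa [← map_mul, inv_mul_cancel₀ hc0, map_one] at h2

theorem mem_of_forall_decompose_mem {I : Ideal R} {y : R}
    (h : ∀ n, (DirectSum.decompose 𝒜 y n : R) ∈ I) : y ∈ I := by
  classical
  rw [← DirectSum.sum_support_decompose 𝒜 y]
  exact I.sum_mem fun n _ => h n

/-- The constant term of t is a nonzero scalar, so the components of y fall into I one after the
other, by induction on the degree. -/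
theorem mem_of_mul_mem (hzero : 𝒜 0 = 1) {I : Ideal R} (hI : I.IsHomogeneous 𝒜) {t y : R}
    (ht : t ∉ irr 𝒜) (hty : t * y ∈ I) : y ∈ I := by
  obtain ⟨c, hc⟩ := exists_sub_mem_irr 𝒜 hzero t
  have hc0 : c ≠ 0 := by
    rintro rfl
    exact ht (by simpa using hc)
  have ht0 : (DirectSum.decompose 𝒜 t 0 : R) = algebraMap k R c := by
    rw [mem_irr_iff, DirectSum.decompose_sub, DirectSum.sub_apply, AddSubgroupClass.coe_sub,
      sub_eq_zero] at hc
    rw [hc]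
    refine DirectSum.decompose_of_mem_same 𝒜 ?_
    rw [hzero]
    exact Submodule.mem_one.2 ⟨c, rfl⟩
  refine mem_of_forall_decompose_mem 𝒜 fun n => ?_
  induction n using Nat.strong_induction_on with
  | _ n ih =>
    have h1 := hI n hty
    rw [DirectSum.decompose_mul, DirectSum.coe_mul_apply_eq_sum_antidiagonal,
      ← Finset.add_sum_erase _ _ (a := (0, n)) (by simp)] at h1
    have h2 : ∑ x ∈ (Finset.HasAntidiagonal.antidiagonal n).erase (0, n),
        (DirectSum.decompose 𝒜 t x.1 : R) * DirectSum.decompose 𝒜 y x.2 ∈ I := by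
      refine I.sum_mem fun x hx => I.mul_mem_left _ (ih _ ?_)
      rw [Finset.mem_erase, Finset.HasAntidiagonal.mem_antidiagonal] at hx
      by_contra hcon
      have : x.1 = 0 := by lia
      exact hx.1 (Prod.ext this (by lia))
    have h3 := (I.add_mem_iff_left h2).1 h1
    simp only [ht0] at h3
    have h4 := I.mul_mem_left (algebraMap k R c⁻¹) h3
    rwa [← mul_assoc, ← map_mul, inv_mul_cancel₀ hc0, map_one, one_mul] at h4

theorem exists_mem_homogeneous_notMem {I P : Ideal R} (hI : I.IsHomogeneous 𝒜) (h : ¬ I ≤ P) :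
    ∃ n, ∃ x ∈ 𝒜 n, x ∈ I ∧ x ∉ P := by
  by_contra! hcon
  exact h fun y hy => mem_of_forall_decompose_mem 𝒜 fun n =>
    hcon n _ (SetLike.coe_mem _) (hI n hy)

theorem exists_pos_mem_notMem {P : Ideal R} (h : ¬ irr 𝒜 ≤ P) :
    ∃ n, 0 < n ∧ ∃ x ∈ 𝒜 n, x ∉ P := by
  obtain ⟨n, x, hx, hxi, hxP⟩ := exists_mem_homogeneous_notMem 𝒜
    (HomogeneousIdeal.irrelevant 𝒜).isHomogeneous h
  rcases Nat.eq_zero_or_pos n with rfl | hn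
  · rw [mem_irr_iff, DirectSum.decompose_of_mem_same 𝒜 hx] at hxi
    exact absurd (hxi ▸ P.zero_mem) hxP
  · exact ⟨n, hn, x, hx, hxP⟩

/-- Homogeneous prime avoidance. -/
theorem exists_pos_mem_forall_notMem (s : Finset (Ideal R)) (hs : ∀ P ∈ s, P.IsPrime)
    (hs' : ∀ P ∈ s, ¬ irr 𝒜 ≤ P) : ∃ n, 0 < n ∧ ∃ x ∈ 𝒜 n, ∀ P ∈ s, x ∉ P := by
  classical
  induction hc : s.card using Nat.strong_induction_on generalizing s with
  | _ c ih =>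
    rcases s.eq_empty_or_nonempty with rfl | ⟨P, hP⟩
    · exact ⟨1, one_pos, 0, zero_mem _, by simp⟩
    -- The primes need not be homogeneous, so they are compared on homogeneous elements only. If
    -- those of Q lie in P, then avoiding P avoids Q and Q can be dropped.
    by_cases hQ : ∃ Q ∈ s.erase P, ∀ n, ∀ x ∈ 𝒜 n, x ∈ Q → x ∈ P
    · obtain ⟨Q, hQ, hQP⟩ := hQ
      have hQs := Finset.mem_of_mem_erase hQ
      obtain ⟨n, hn, x, hx, hxs⟩ := ih (s.erase Q).card
        (by rw [← hc]; exact Finset.card_erase_lt_of_mem hQs) (s.erase Q)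
        (fun P hP => hs P (Finset.mem_of_mem_erase hP))
        (fun P hP => hs' P (Finset.mem_of_mem_erase hP)) rfl
      refine ⟨n, hn, x, hx, fun P' hP' hxP' => ?_⟩
      by_cases hPQ : P' = Q
      · subst hPQ
        exact hxs P (Finset.mem_erase.2 ⟨(Finset.ne_of_mem_erase hQ).symm, hP⟩)
          (hQP n x hx hxP')
      · exact hxs P' (Finset.mem_erase.2 ⟨hPQ, hP'⟩) hxP'
    push Not at hQ
    obtain ⟨n, hn, x, hx, hxs⟩ := ih (s.erase P).card
      (by rw [← hc]; exact Finset.card_erase_lt_of_mem hP) (s.erase P)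
      (fun P hP => hs P (Finset.mem_of_mem_erase hP))
      (fun P hP => hs' P (Finset.mem_of_mem_erase hP)) rfl
    by_cases hxP : x ∈ P
    swap
    · refine ⟨n, hn, x, hx, fun P' hP' => ?_⟩
      by_cases hPP : P' = P
      · exact hPP ▸ hxP
      · exact hxs P' (Finset.mem_erase.2 ⟨hPP, hP'⟩)
    have hPp := hs P hP
    obtain ⟨m, hm, w, hw, hwP⟩ := exists_pos_mem_notMem 𝒜 (hs' P hP)
    choose! e z hz hzQ hzP using hQ
    -- This product lies in every other prime but not in P, whereas x lies in P and in no other.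
    -- Powers of the two with a common degree are added below.
    have hdeg : w * ∏ Q ∈ s.erase P, z Q ∈ 𝒜 (m + ∑ Q ∈ s.erase P, e Q) :=
      SetLike.GradedMul.mul_mem hw (SetLike.prod_mem_graded _ _ _ hz)
    set y := w * ∏ Q ∈ s.erase P, z Q
    set l := m + ∑ Q ∈ s.erase P, e Q
    have hyP : y ∉ P := fun h => by
      rcases hPp.mem_or_mem h with h | h
      · exact hwP h
      · obtain ⟨Q, hQ, hQ'⟩ := (hPp.prod_mem_iff).1 h
        exact hzP Q hQ hQ'
    have hyQ : ∀ Q ∈ s.erase P, y ∈ Q := fun Q hQ =>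
      Ideal.mul_mem_left _ _ (Ideal.mem_of_dvd _ (Finset.dvd_prod_of_mem z hQ) (hzQ Q hQ))
    have hl : 0 < l := by lia
    refine ⟨l * n, Nat.mul_pos hl hn, x ^ l + y ^ n, ?_, fun P' hP' h => ?_⟩
    · refine add_mem (SetLike.pow_mem_graded l hx) ?_
      rw [mul_comm l n]
      exact SetLike.pow_mem_graded n hdeg
    · by_cases hPP : P' = P
      · subst hPP
        exact hyP (hPp.mem_of_pow_mem n (((P'.add_mem_iff_right
          (P'.pow_mem_of_mem hxP l hl)).1 h)))
      · have hP'' := Finset.mem_erase.2 ⟨hPP, hP'⟩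
        exact hxs P' hP'' ((hs P' hP').mem_of_pow_mem l ((P'.add_mem_iff_left
          (P'.pow_mem_of_mem (hyQ P' hP'') n hn)).1 h))

/-- Take components of degree n in any representation. The clause for n < b i is needed because n -
b i is truncated there. -/
theorem exists_homogeneous_repr {ι : Type*} [Fintype ι] {g : ι → R} {b : ι → ℕ}
    (hg : ∀ i, g i ∈ 𝒜 (b i)) {J : Ideal R} (hJ : J.IsHomogeneous 𝒜) {n : ℕ} {y : R}
    (hy : y ∈ 𝒜 n) (h : y ∈ J ⊔ Ideal.span (Set.range g)) :
    ∃ j ∈ J, ∃ c : ι → R, j ∈ 𝒜 n ∧ y = j + ∑ i, c i * g i ∧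
      ∀ i, (b i ≤ n → c i ∈ 𝒜 (n - b i)) ∧ (n < b i → c i = 0) := by
  obtain ⟨j, hj, z, hz, rfl⟩ := Submodule.mem_sup.1 h
  obtain ⟨f, rfl⟩ := Ideal.mem_span_range_iff_exists_fun.1 hz
  refine ⟨DirectSum.decompose 𝒜 j n, hJ n hj,
    fun i => if b i ≤ n then DirectSum.decompose 𝒜 (f i) (n - b i) else 0,
    SetLike.coe_mem _, ?_, fun i => ⟨fun hi => ?_, fun hi => ?_⟩⟩
  · conv_lhs => rw [← DirectSum.decompose_of_mem_same 𝒜 hy]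
    rw [DirectSum.decompose_add, DirectSum.add_apply, Submodule.coe_add, DirectSum.decompose_sum,
      DFinsupp.finsetSum_apply, AddSubmonoidClass.coe_finsetSum]
    congr 1
    refine Finset.sum_congr rfl fun i _ => ?_
    rw [DirectSum.coe_decompose_mul_of_right_mem 𝒜 n (hg i)]
    by_cases hi : b i ≤ n <;> simp only [hi, if_true, if_false, zero_mul]
  · simp only [if_pos hi]
    exact SetLike.coe_mem _
  · exact if_neg (by lia)

theorem exists_generators_irr [IsNoetherianRing R] :
    ∃ (s : Finset R) (b : s → ℕ), (∀ i, 0 < b i) ∧ (∀ i : s, (i : R) ∈ 𝒜 (b i)) ∧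
      Ideal.span (Set.range ((↑) : s → R)) = irr 𝒜 := by
  have h := HomogeneousIdeal.irrelevant_eq_span 𝒜
  have hfg : (Ideal.span (⋃ i > 0, (𝒜 i : Set R))).FG := IsNoetherian.noetherian _
  obtain ⟨s, hs, hs'⟩ := (Submodule.fg_span_iff_fg_span_finset_subset _).1 hfg
  have : ∀ i : s, ∃ n, 0 < n ∧ (i : R) ∈ 𝒜 n := fun i => by
    simpa using hs i.2
  choose b hb hb' using this
  refine ⟨s, b, hb, hb', ?_⟩
  rw [Subtype.range_coe_subtype]
  exact (hs'.symm.trans h.symm)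

theorem finite_component [IsNoetherianRing R] (hzero : 𝒜 0 = 1) (n : ℕ) :
    Module.Finite k (𝒜 n) := by
  obtain ⟨s, b, hb, hs, hspan⟩ := exists_generators_irr 𝒜
  induction n using Nat.strong_induction_on with
  | _ n ih =>
    rcases Nat.eq_zero_or_pos n with rfl | hn
    · rw [hzero, Submodule.one_eq_range]
      exact Module.Finite.range _
    · have h1 : ∀ i : s, Module.Finite k
          (if b i ≤ n then (𝒜 (n - b i)).map (LinearMap.mulRight k (i : R)) else ⊥ :
            Submodule k R) := fun i => by
        by_cases hi : b i ≤ n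
        · have := ih (n - b i) (by have := hb i; lia)
          rw [if_pos hi]
          exact Module.Finite.map _ _
        · rw [if_neg hi]
          exact Module.Finite.bot _ _
      have h2 : 𝒜 n ≤ ⨆ i : s,
          (if b i ≤ n then (𝒜 (n - b i)).map (LinearMap.mulRight k (i : R)) else ⊥ :
            Submodule k R) := fun y hy => by
        obtain ⟨j, hj, c, -, rfl, hc⟩ := exists_homogeneous_repr 𝒜 hs (J := ⊥)
          (Ideal.IsHomogeneous.bot 𝒜) hy (by
            rw [bot_sup_eq, hspan]
            exact mem_irr_of_mem 𝒜 hn hy)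
        rw [Ideal.mem_bot.1 hj, zero_add]
        refine Submodule.sum_mem _ fun i _ => Submodule.mem_iSup_of_mem i ?_
        split_ifs with hi
        · exact ⟨c i, (hc i).1 hi, rfl⟩
        · rw [(hc i).2 (by lia)]; simp
      exact Submodule.finiteDimensional_of_le h2

theorem exists_forall_le_of_irr_le_radical [IsNoetherianRing R] {J : Ideal R}
    (hJ : irr 𝒜 ≤ J.radical) : ∃ N, ∀ n, N ≤ n → ∀ y ∈ 𝒜 n, y ∈ J := by
  obtain ⟨s, b, hb, hs, hspan⟩ := exists_generators_irr 𝒜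
  obtain ⟨l, hl⟩ := Ideal.exists_pow_le_of_le_radical_of_fg hJ (IsNoetherian.noetherian _)
  let D := ∑ i, b i
  have hD : ∀ i, b i ≤ D := fun i => Finset.single_le_sum (fun _ _ => Nat.zero_le _)
    (Finset.mem_univ i)
  -- The condition says n > (l - 1) D, written without subtraction: splitting off one generator
  -- lowers the degree by at most D.
  have key : ∀ l n, l * D + 1 ≤ n + D → ∀ y ∈ 𝒜 n, y ∈ irr 𝒜 ^ l := by
    intro l
    induction l with
    | zero => intro n _ y _; simp
    | succ l ih =>
      intro n hn y hy
      have hn' : l * D + 1 ≤ n := by rw [add_mul] at hn; lia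
      obtain ⟨j, hj, c, -, rfl, hc⟩ := exists_homogeneous_repr 𝒜 hs (J := ⊥)
        (Ideal.IsHomogeneous.bot 𝒜) hy (by
          rw [bot_sup_eq, hspan]
          exact mem_irr_of_mem 𝒜 (by lia) hy)
      rw [Ideal.mem_bot.1 hj, zero_add]
      refine Ideal.sum_mem _ fun i _ => ?_
      by_cases hi : b i ≤ n
      · rw [pow_succ]
        refine Ideal.mul_mem_mul (ih (n - b i) ?_ _ ((hc i).1 hi))
          (mem_irr_of_mem 𝒜 (hb i) (hs i))
        have := hD i
        lia
      · rw [(hc i).2 (by lia), zero_mul]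
        exact Ideal.zero_mem _
  exact ⟨l * D + 1, fun n hn y hy => hl (key l n (by lia) y hy)⟩

end GradedRing

/-! ### Krull dimension of graded quotients. -/

theorem ringKrullDim_le_of_isIntegral {A B : Type*} [CommRing A] [CommRing B] (f : A →+* B)
    (hf : f.IsIntegral) : ringKrullDim B ≤ ringKrullDim A := by
  let := f.toAlgebra
  have : Algebra.IsIntegral A B := ⟨hf⟩
  refine Order.krullDim_le_of_strictMono (PrimeSpectrum.comap f) fun P Q hPQ => ?_
  obtain ⟨x, hxQ, hxP⟩ := Set.exists_of_ssubset (show (P.asIdeal : Set B) ⊂ Q.asIdeal from hPQ)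
  exact Ideal.comap_lt_comap_of_integral_mem_sdiff (R := A) (le_of_lt hPQ) ⟨hxQ, hxP⟩
    (Algebra.IsIntegral.isIntegral x)

section GradedRing

variable {k : Type v} {R : Type u} [Field k] [CommRing R] [Algebra k R]
variable (𝒜 : ℕ → Submodule k R) [GradedAlgebra 𝒜]

/-- By graded Nakayama, R/J is finite over a polynomial ring acting through the g i: the components
of degree below N generate it, since in degrees at least N every element is a combination of the g i
modulo J. -/
theorem ringKrullDim_quotient_le_of_irr_le_radical [IsNoetherianRing R] (hzero : 𝒜 0 = 1) {ι : Type*}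
    [Fintype ι] {g : ι → R} {b : ι → ℕ} (hb : ∀ i, 0 < b i) (hg : ∀ i, g i ∈ 𝒜 (b i)) {J : Ideal R}
    (hJ : J.IsHomogeneous 𝒜) (h : irr 𝒜 ≤ (J ⊔ Ideal.span (Set.range g)).radical) :
    ringKrullDim (R ⧸ J) ≤ Fintype.card ι := by
  obtain ⟨N, hN⟩ := exists_forall_le_of_irr_le_radical 𝒜 h
  let f : MvPolynomial (ι) k →ₐ[k] R ⧸ J := MvPolynomial.aeval fun i => Ideal.Quotient.mk J (g i)
  suffices hf : f.toRingHom.Finite by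
    refine (ringKrullDim_le_of_isIntegral _ hf.to_isIntegral).trans ?_
    rw [MvPolynomial.ringKrullDim_of_isNoetherianRing, ringKrullDim_eq_zero_of_field]
    simp
  let := f.toRingHom.toAlgebra
  have hsmul : ∀ (a : MvPolynomial (ι) k) (x : R ⧸ J), a • x = f a * x := fun a x => rfl
  have hfin : ∀ m, ∃ F : Finset R, Submodule.span k (F : Set R) = 𝒜 m := fun m =>
    Submodule.fg_def.1 (Module.Finite.iff_fg.1 (finite_component 𝒜 hzero m)) |>.elim
      fun S hS => ⟨hS.1.toFinset, by simpa using hS.2⟩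
  choose F hF using hfin
  let S : Set (R ⧸ J) := ⋃ m : Fin N, Ideal.Quotient.mk J '' (F m)
  have hS : S.Finite := Set.finite_iUnion fun m => (F m).finite_toSet.image _
  let W : Submodule (MvPolynomial (ι) k) (R ⧸ J) := Submodule.span _ S
  have key : ∀ m, ∀ y ∈ 𝒜 m, Ideal.Quotient.mk J y ∈ W := by
    intro m
    induction m using Nat.strong_induction_on with
    | _ m ih =>
      intro y hy
      rcases lt_or_ge m N with hm | hm
      · rw [← hF] at hy
        induction hy using Submodule.span_induction with
        | mem y hy => exact Submodule.subset_span (Set.mem_iUnion.2 ⟨⟨m, hm⟩, y, hy, rfl⟩)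
        | zero => rw [map_zero]; exact zero_mem _
        | add y z _ _ h1 h2 => rw [map_add]; exact add_mem h1 h2
        | smul c y _ h1 =>
          have : Ideal.Quotient.mk J (c • y) = (MvPolynomial.C c : MvPolynomial (ι) k) •
              Ideal.Quotient.mk J y := by
            rw [hsmul, MvPolynomial.aeval_C, Algebra.smul_def, map_mul]; rfl
          rw [this]
          exact W.smul_mem _ h1
      · obtain ⟨j, hj, c, -, rfl, hc⟩ := exists_homogeneous_repr 𝒜 hg hJ hy (hN m hm y hy)
        rw [map_add, Ideal.Quotient.eq_zero_iff_mem.2 hj, zero_add, map_sum]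
        refine Submodule.sum_mem _ fun i _ => ?_
        by_cases hi : b i ≤ m
        · have : Ideal.Quotient.mk J (c i * g i) = (MvPolynomial.X i : MvPolynomial (ι) k) •
              Ideal.Quotient.mk J (c i) := by
            rw [hsmul, MvPolynomial.aeval_X, map_mul, mul_comm]
          rw [this]
          exact W.smul_mem _ (ih _ (by have := hb i; lia) _ ((hc i).1 hi))
        · rw [(hc i).2 (by lia), zero_mul, map_zero]
          exact zero_mem _
  refine ⟨⟨hS.toFinset, ?_⟩⟩
  rw [Set.Finite.coe_toFinset, eq_top_iff]
  rintro x -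
  obtain ⟨r, rfl⟩ := Ideal.Quotient.mk_surjective x
  classical
  rw [← DirectSum.sum_support_decompose 𝒜 r, map_sum]
  exact Submodule.sum_mem _ fun m _ => key m _ (SetLike.coe_mem _)

end GradedRing

section RingEquiv

attribute [local instance] RingHomInvPair.of_ringEquiv

theorem hasInjectiveDimensionLE_of_ringEquiv {A B : Type u} [CommRing A] [CommRing B] (e : A ≃+* B)
    (n : ℕ) (h : HasInjectiveDimensionLE (ModuleCat.of A A) n) :
    HasInjectiveDimensionLE (ModuleCat.of B B) n := by
  let e' : A ≃ₛₗ[RingHomClass.toRingHom e] B :=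
    { e with map_smul' := fun a b => by simp }
  exact (ModuleCat.hasInjectiveDimensionLE_iff_of_semiLinearEquiv e
    (M := ModuleCat.of A A) (N := ModuleCat.of B B) e' n).1 h

end RingEquiv

/-! ### Associated primes and homogeneous regular sequences. -/

section AssociatedPrimes

variable {R : Type u} [CommRing R]

theorem isAssociatedPrime_quotient_iff [IsNoetherianRing R] {I P : Ideal R} :
    IsAssociatedPrime P (R ⧸ I) ↔ P.IsPrime ∧ ∃ z, ∀ r, r ∈ P ↔ r * z ∈ I := by
  rw [isAssociatedPrime_iff]
  refine and_congr_right fun _ => ?_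
  have key : ∀ z r : R, r ∈ (⊥ : Submodule R (R ⧸ I)).colon {Ideal.Quotient.mk I z} ↔ r * z ∈ I :=
    fun z r => by
      rw [Submodule.mem_colon_singleton, Submodule.mem_bot, ← Ideal.Quotient.mk_eq_mk,
        ← Submodule.Quotient.mk_smul, Submodule.Quotient.mk_eq_zero, smul_eq_mul]
  constructor
  · rintro ⟨x, hx⟩
    obtain ⟨z, rfl⟩ := Ideal.Quotient.mk_surjective x
    exact ⟨z, fun r => by rw [hx, key]⟩
  · rintro ⟨z, hz⟩
    exact ⟨Ideal.Quotient.mk I z, by ext r; rw [hz, key]⟩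

theorem exists_isAssociatedPrime_of_notMem [IsNoetherianRing R] {I : Ideal R} {z : R}
    (hz : z ∉ I) : ∃ P, IsAssociatedPrime P (R ⧸ I) ∧ ∀ r, r * z ∈ I → r ∈ P := by
  obtain ⟨P, hP, hle⟩ := exists_le_isAssociatedPrime_of_isNoetherianRing R
    (Ideal.Quotient.mk I z) (by rwa [Ne, Ideal.Quotient.eq_zero_iff_mem])
  refine ⟨P, hP, fun r hr => hle ?_⟩
  rw [Submodule.mem_colon_singleton, Submodule.mem_bot, ← Ideal.Quotient.mk_eq_mk,
    ← Submodule.Quotient.mk_smul, Submodule.Quotient.mk_eq_zero, smul_eq_mul]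
  exact hr

end AssociatedPrimes

section GradedRing

variable {k : Type v} {R : Type u} [Field k] [CommRing R] [Algebra k R]
variable (𝒜 : ℕ → Submodule k R) [GradedAlgebra 𝒜]

/-- `I` is generated by a regular sequence of `n` homogeneous elements of positive degree. -/
inductive IsRegularIdeal : ℕ → Ideal R → Prop
  | bot : IsRegularIdeal 0 ⊥
  | sup {n : ℕ} {I : Ideal R} (h : IsRegularIdeal n I) {b : ℕ} (hb : 0 < b) {x : R}
      (hx : x ∈ 𝒜 b) (hreg : ∀ y, x * y ∈ I → y ∈ I) :
      IsRegularIdeal (n + 1) (I ⊔ Ideal.span {x})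

/-- Some regular sequence of `c` homogeneous elements of positive degree on `R ⧸ I` generates an
ideal that is primary to the irrelevant ideal. -/
inductive HasParameters : ℕ → Ideal R → Prop
  | zero {I : Ideal R} (h : irr 𝒜 ≤ I.radical) : HasParameters 0 I
  | succ {c : ℕ} {I : Ideal R} {b : ℕ} (hb : 0 < b) {x : R}
      (hx : x ∈ 𝒜 b) (hreg : ∀ y, x * y ∈ I → y ∈ I)
      (h : HasParameters c (I ⊔ Ideal.span {x})) : HasParameters (c + 1) I

variable {𝒜}

theorem isHomogeneous_span_singleton {b : ℕ} {x : R} (hx : x ∈ 𝒜 b) :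
    (Ideal.span {x}).IsHomogeneous 𝒜 :=
  Ideal.homogeneous_span 𝒜 _ fun y hy => by
    rw [Set.mem_singleton_iff.1 hy]; exact ⟨b, hx⟩

theorem IsRegularIdeal.isHomogeneous {n : ℕ} {I : Ideal R} (h : IsRegularIdeal 𝒜 n I) :
    I.IsHomogeneous 𝒜 := by
  induction h with
  | bot => exact Ideal.IsHomogeneous.bot 𝒜
  | sup h hb hx hreg ih => exact ih.sup (isHomogeneous_span_singleton hx)

theorem IsRegularIdeal.le_irr {n : ℕ} {I : Ideal R} (h : IsRegularIdeal 𝒜 n I) : I ≤ irr 𝒜 := by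
  induction h with
  | bot => exact bot_le
  | sup h hb hx hreg ih =>
    exact sup_le ih ((Ideal.span_singleton_le_iff_mem _).2 (mem_irr_of_mem 𝒜 hb hx))

theorem HasParameters.of_isRegularIdeal {n c : ℕ} {I : Ideal R} (h : IsRegularIdeal 𝒜 n I)
    (hc : HasParameters 𝒜 c I) : HasParameters 𝒜 (n + c) ⊥ := by
  induction h generalizing c with
  | bot => simpa using hc
  | @sup n I h b hb x hx hreg ih =>
    rw [show n + 1 + c = n + (c + 1) by ring]
    exact ih (.succ hb hx hreg hc)

theorem HasParameters.exists_family {c : ℕ} {I : Ideal R} (h : HasParameters 𝒜 c I) :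
    ∃ (g : Fin c → R) (b : Fin c → ℕ), (∀ i, 0 < b i) ∧ (∀ i, g i ∈ 𝒜 (b i)) ∧
      irr 𝒜 ≤ (I ⊔ Ideal.span (Set.range g)).radical := by
  induction h with
  | zero h => exact ⟨Fin.elim0, Fin.elim0, fun i => i.elim0, fun i => i.elim0, by simpa using h⟩
  | @succ c I b hb x hx hreg h ih =>
    obtain ⟨g, b', hb', hg, hle⟩ := ih
    refine ⟨Fin.cons x g, Fin.cons b b', Fin.cases hb hb', Fin.cases hx hg, ?_⟩
    rwa [Fin.range_cons, Set.insert_eq, Ideal.span_union, ← sup_assoc]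

theorem HasParameters.ringKrullDim_le [IsNoetherianRing R] (hzero : 𝒜 0 = 1) {c : ℕ}
    {I : Ideal R} (h : HasParameters 𝒜 c I) (hI : I.IsHomogeneous 𝒜) :
    ringKrullDim (R ⧸ I) ≤ c := by
  obtain ⟨g, b, hb, hg, hle⟩ := h.exists_family
  simpa using ringKrullDim_quotient_le_of_irr_le_radical 𝒜 hzero hb hg hI hle

/-- If w = j + x t with j in I, then t has the same annihilator modulo I, because x is regular. Were
this always possible, z would lie in I + (x^n) for all n; comparing degrees would put z in I. -/
theorem exists_colon_eq_notMem_sup {I : Ideal R} (hI : I.IsHomogeneous 𝒜) {b : ℕ} (hb : 0 < b)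
    {x : R} (hx : x ∈ 𝒜 b) (hreg : ∀ y, x * y ∈ I → y ∈ I) {P : Ideal R} {z : R}
    (hP : P ≠ ⊤) (hz : ∀ r, r ∈ P ↔ r * z ∈ I) :
    ∃ w, (∀ r, r ∈ P ↔ r * w ∈ I) ∧ w ∉ I ⊔ Ideal.span {x} := by
  by_contra! hcon
  have step : ∀ n, ∀ w, (∀ r, r ∈ P ↔ r * w ∈ I) → ∃ j ∈ I, ∃ t, w = j + x ^ n * t := by
    intro n
    induction n with
    | zero => intro w _; exact ⟨0, I.zero_mem, w, by simp⟩
    | succ n ih =>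
      intro w hw
      obtain ⟨j, hj, s, hs, rfl⟩ := Submodule.mem_sup.1 (hcon w hw)
      obtain ⟨t, rfl⟩ := Ideal.mem_span_singleton.1 hs
      obtain ⟨j', hj', t', ht'⟩ := ih t fun r => by
        rw [hw r, mul_add, I.add_mem_iff_right (I.mul_mem_left r hj)]
        exact ⟨fun h => hreg _ (by rwa [mul_left_comm]), fun h => by
          rw [mul_left_comm]; exact I.mul_mem_left _ h⟩
      refine ⟨j + x * j', I.add_mem hj (I.mul_mem_left _ hj'), t', ?_⟩
      rw [ht']; ring
  refine hP (P.eq_top_iff_one.2 ((hz 1).2 ?_))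
  rw [one_mul]
  refine mem_of_forall_decompose_mem 𝒜 fun n => ?_
  obtain ⟨j, hj, t, rfl⟩ := step (n + 1) z hz
  rw [DirectSum.decompose_add, DirectSum.add_apply, Submodule.coe_add,
    DirectSum.coe_decompose_mul_of_left_mem_of_not_le 𝒜 (SetLike.pow_mem_graded (n + 1) hx)
      (by rw [smul_eq_mul, not_le]; nlinarith), add_zero]
  exact hI n hj

/-- This is depth R/I ≤ dim R/P. Some prime Q associated to R/(I + x) contains P and x, while x ∉ P,
so each parameter costs at least one dimension. -/
theorem HasParameters.le_ringKrullDim [IsNoetherianRing R] {c : ℕ}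
    {I : Ideal R} (h : HasParameters 𝒜 c I) (hI : I.IsHomogeneous 𝒜) {P : Ideal R}
    (hP : IsAssociatedPrime P (R ⧸ I)) : c ≤ ringKrullDim (R ⧸ P) := by
  induction h generalizing P with
  | zero h =>
    have := hP.isPrime
    exact_mod_cast ringKrullDim_nonneg_of_nontrivial
  | @succ c I b hb x hx hreg h ih =>
    obtain ⟨hPp, z, hz⟩ := isAssociatedPrime_quotient_iff.1 hP
    obtain ⟨w, hw, hwx⟩ := exists_colon_eq_notMem_sup hI hb hx hreg hPp.ne_top hz
    obtain ⟨Q, hQ, hQw⟩ := exists_isAssociatedPrime_of_notMem hwx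
    have h1 := ih (hI.sup (isHomogeneous_span_singleton hx)) hQ
    have hPQ : P ≤ Q := fun r hr => hQw r (Ideal.mem_sup_left ((hw r).1 hr))
    have hxQ : x ∈ Q := hQw x (Ideal.mul_mem_right _ _
      (Ideal.mem_sup_right (Ideal.mem_span_singleton_self x)))
    have hxP : x ∉ P := fun hxP => hPp.ne_top (P.eq_top_iff_one.2 ((hz 1).2 (by
      rw [one_mul]; exact hreg z ((hz x).1 hxP))))
    have h2 := ringKrullDim_succ_le_of_surjective (Ideal.Quotient.factor hPQ)
      (Ideal.Quotient.factor_surjective hPQ) (r := Ideal.Quotient.mk P x)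
      (mem_nonZeroDivisors_of_ne_zero (by rwa [Ne, Ideal.Quotient.eq_zero_iff_mem]))
      (by simpa [Ideal.Quotient.eq_zero_iff_mem] using hxQ)
    refine le_trans ?_ h2
    push_cast
    gcongr

theorem HasParameters.ringKrullDim_eq [IsNoetherianRing R] [Nontrivial R] (hzero : 𝒜 0 = 1) {c : ℕ}
    (h : HasParameters 𝒜 c ⊥) : ringKrullDim R = c := by
  have e := ringKrullDim_eq_of_ringEquiv (RingEquiv.quotientBot R)
  refine le_antisymm ?_ ?_
  · rw [← e]
    exact h.ringKrullDim_le hzero (Ideal.IsHomogeneous.bot 𝒜)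
  · obtain ⟨P, hP, -⟩ := exists_isAssociatedPrime_of_notMem (I := (⊥ : Ideal R)) (z := 1)
      (by simp)
    exact (h.le_ringKrullDim (Ideal.IsHomogeneous.bot 𝒜) hP).trans (ringKrullDim_quotient_le P)

end GradedRing

/-! ### Gorenstein implies Cohen–Macaulay with simple socle. -/

section GradedRing

variable {k : Type v} {R : Type u} [Field k] [CommRing R] [Algebra k R]
variable {𝒜 : ℕ → Submodule k R} [GradedAlgebra 𝒜]

section Localization

variable [(irr 𝒜).IsPrime]

/-- Homogeneous ideals are contracted from the localization, since elements outside R_+ are regular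
modulo them (`mem_of_mul_mem`). -/
theorem algebraMap_mem_map_iff (hzero : 𝒜 0 = 1) {I : Ideal R} (hI : I.IsHomogeneous 𝒜) {y : R} :
    algebraMap R (Localization.AtPrime (irr 𝒜)) y ∈
      I.map (algebraMap R (Localization.AtPrime (irr 𝒜))) ↔ y ∈ I := by
  refine ⟨fun h => ?_, fun h => Ideal.mem_map_of_mem _ h⟩
  obtain ⟨⟨i, t⟩, hit⟩ := (IsLocalization.mem_map_algebraMap_iff (irr 𝒜).primeCompl _).1 h
  rw [← map_mul] at hit
  obtain ⟨c, hc⟩ := (IsLocalization.eq_iff_exists (irr 𝒜).primeCompl _).1 hit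
  refine mem_of_mul_mem 𝒜 hzero hI (t := c * t) (c * t).2 ?_
  have : (c * t : R) * y = c * i := by rw [← hc]; ring
  rw [this]
  exact I.mul_mem_left _ i.2

theorem mul_algebraMap_mem_map_iff (hzero : 𝒜 0 = 1) {I : Ideal R} (hI : I.IsHomogeneous 𝒜)
    {w y : R} (t : (irr 𝒜).primeCompl) :
    IsLocalization.mk' (Localization.AtPrime (irr 𝒜)) w t *
      algebraMap R (Localization.AtPrime (irr 𝒜)) y ∈
      I.map (algebraMap R (Localization.AtPrime (irr 𝒜))) ↔ w * y ∈ I := by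
  rw [← algebraMap_mem_map_iff hzero hI,
    ← Ideal.unit_mul_mem_iff_mem _
      (IsLocalization.map_units (Localization.AtPrime (irr 𝒜)) t), ← mul_assoc,
    IsLocalization.mk'_spec', ← map_mul]

theorem IsRegularIdeal.exists_hasInjectiveDimensionLE (hzero : 𝒜 0 = 1)
    (hgor : ∃ n : ℕ, HasInjectiveDimensionLE (ModuleCat.of (Localization.AtPrime (irr 𝒜))
      (Localization.AtPrime (irr 𝒜))) n) {n : ℕ} {I : Ideal R} (h : IsRegularIdeal 𝒜 n I) :
    ∃ m : ℕ, HasInjectiveDimensionLE (ModuleCat.of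
      (Localization.AtPrime (irr 𝒜) ⧸ I.map (algebraMap R (Localization.AtPrime (irr 𝒜))))
      (Localization.AtPrime (irr 𝒜) ⧸ I.map (algebraMap R (Localization.AtPrime (irr 𝒜))))) m := by
  induction h with
  | bot =>
    obtain ⟨m, hm⟩ := hgor
    exact ⟨m, hasInjectiveDimensionLE_of_ringEquiv
      ((RingEquiv.quotientBot _).symm.trans (Ideal.quotEquivOfEq Ideal.map_bot.symm)) m hm⟩
  | @sup n I h b hb x hx hreg ih =>
    obtain ⟨m, hm⟩ := ih
    set f := algebraMap R (Localization.AtPrime (irr 𝒜))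
    have hx0 : Ideal.Quotient.mk (I.map f) (f x) ∈ nonZeroDivisors _ := by
      rw [mem_nonZeroDivisors_iff_right]
      intro z hz
      obtain ⟨z, rfl⟩ := Ideal.Quotient.mk_surjective z
      obtain ⟨w, t, rfl⟩ := IsLocalization.exists_mk'_eq (irr 𝒜).primeCompl z
      rw [← map_mul, Ideal.Quotient.eq_zero_iff_mem,
        mul_algebraMap_mem_map_iff hzero h.isHomogeneous, mul_comm] at hz
      rw [Ideal.Quotient.eq_zero_iff_mem, ← mul_one (IsLocalization.mk' _ w t), ← map_one f,
        mul_algebraMap_mem_map_iff hzero h.isHomogeneous, mul_one]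
      exact hreg w hz
    refine ⟨m, hasInjectiveDimensionLE_of_ringEquiv ?_ m (hasInjectiveDimensionLE_quotient hx0 m hm)⟩
    refine (Ideal.quotEquivOfEq ?_).trans
      ((DoubleQuot.quotQuotEquivQuotSup (I.map f) (Ideal.span {f x})).trans
        (Ideal.quotEquivOfEq ?_))
    · rw [Ideal.map_span, Set.image_singleton]
    · rw [Ideal.map_sup, Ideal.map_span, Set.image_singleton]

/-- The localization of R/I at R_+ has finite self-injective dimension, and s gives it a nonzero
socle. So it is self-injective: its maximal ideal is nil, and any two nonzero socle elements are
multiples of each other. -/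
theorem IsRegularIdeal.socle [IsNoetherianRing R] (hzero : 𝒜 0 = 1)
    (hgor : ∃ n : ℕ, HasInjectiveDimensionLE (ModuleCat.of (Localization.AtPrime (irr 𝒜))
      (Localization.AtPrime (irr 𝒜))) n) {n : ℕ} {I : Ideal R} (h : IsRegularIdeal 𝒜 n I)
    {s : R} (hs : s ∉ I) (hs' : ∀ y ∈ irr 𝒜, y * s ∈ I) :
    irr 𝒜 ≤ I.radical ∧
      ∀ v, (∀ y ∈ irr 𝒜, y * v ∈ I) → ∃ c : k, v - algebraMap k R c * s ∈ I := by
  obtain ⟨m, hm⟩ := h.exists_hasInjectiveDimensionLE hzero hgor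
  have hI := h.isHomogeneous
  set S := Localization.AtPrime (irr 𝒜)
  set f := algebraMap R S
  have hs0 : Ideal.Quotient.mk (I.map f) (f s) ≠ 0 := by
    rwa [Ne, Ideal.Quotient.eq_zero_iff_mem, algebraMap_mem_map_iff hzero hI]
  have hnt : Nontrivial (S ⧸ I.map f) := ⟨_, _, hs0⟩
  have hloc : IsLocalRing (S ⧸ I.map f) :=
    IsLocalRing.of_surjective' (Ideal.Quotient.mk (I.map f)) Ideal.Quotient.mk_surjective
  have hmax : ∀ y ∈ IsLocalRing.maximalIdeal (S ⧸ I.map f),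
      ∃ w ∈ irr 𝒜, ∃ t : (irr 𝒜).primeCompl, y = Ideal.Quotient.mk _ (IsLocalization.mk' S w t) := by
    intro y hy
    obtain ⟨z, rfl⟩ := Ideal.Quotient.mk_surjective y
    obtain ⟨w, t, rfl⟩ := IsLocalization.exists_mk'_eq (irr 𝒜).primeCompl z
    refine ⟨w, ?_, t, rfl⟩
    by_contra hw
    have : IsUnit (IsLocalization.mk' S w t) :=
      (IsLocalization.AtPrime.isUnit_mk'_iff S (irr 𝒜) w t).2 hw
    exact hy (this.map _)
  have hinj : Module.Injective (S ⧸ I.map f) (S ⧸ I.map f) := by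
    refine injective_of_hasInjectiveDimensionLE hs0 (fun y hy => ?_) m hm
    obtain ⟨w, hw, t, rfl⟩ := hmax y hy
    rw [← map_mul, Ideal.Quotient.eq_zero_iff_mem, mul_algebraMap_mem_map_iff hzero hI]
    exact hs' w hw
  refine ⟨fun y hy => ?_, fun v hv => ?_⟩
  · have hy' : Ideal.Quotient.mk (I.map f) (f y) ∈ IsLocalRing.maximalIdeal (S ⧸ I.map f) := by
      rw [IsLocalRing.mem_maximalIdeal, mem_nonunits_iff]
      intro hu
      obtain ⟨z, hz⟩ := hu.exists_left_inv
      obtain ⟨z, rfl⟩ := Ideal.Quotient.mk_surjective z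
      obtain ⟨w, t, rfl⟩ := IsLocalization.exists_mk'_eq (irr 𝒜).primeCompl z
      apply hs0
      rw [← one_mul (Ideal.Quotient.mk (I.map f) (f s)), ← hz, ← map_mul, ← map_mul,
        Ideal.Quotient.eq_zero_iff_mem, mul_assoc, ← map_mul,
        mul_algebraMap_mem_map_iff hzero hI]
      exact I.mul_mem_left _ (hs' y hy)
    obtain ⟨l, hl⟩ := isNilpotent_of_injective hy'
    rw [← map_pow, ← map_pow, Ideal.Quotient.eq_zero_iff_mem,
      algebraMap_mem_map_iff hzero hI] at hl
    exact ⟨l, hl⟩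
  · obtain ⟨c, hc⟩ := exists_mul_eq_of_injective (B := S ⧸ I.map f)
      (u := Ideal.Quotient.mk _ (f s)) (v := Ideal.Quotient.mk _ (f v)) (by
        intro y hy
        obtain ⟨z, rfl⟩ := Ideal.Quotient.mk_surjective y
        obtain ⟨w, t, rfl⟩ := IsLocalization.exists_mk'_eq (irr 𝒜).primeCompl z
        rw [← map_mul, Ideal.Quotient.eq_zero_iff_mem,
          mul_algebraMap_mem_map_iff hzero hI] at hy ⊢
        by_cases hw : w ∈ irr 𝒜
        · exact hv w hw
        · exact absurd (mem_of_mul_mem 𝒜 hzero hI hw hy) hs)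
    obtain ⟨z, rfl⟩ := Ideal.Quotient.mk_surjective c
    obtain ⟨w, t, rfl⟩ := IsLocalization.exists_mk'_eq (irr 𝒜).primeCompl z
    have h1 : (t : R) * v - w * s ∈ I := by
      rw [← map_mul, Ideal.Quotient.eq] at hc
      have h2 := Ideal.mul_mem_left _ (f t) hc
      rwa [mul_sub, ← mul_assoc, IsLocalization.mk'_spec', ← map_mul, ← map_mul, ← map_sub,
        algebraMap_mem_map_iff hzero hI] at h2
    -- As R_+ kills v and s modulo I, the coefficients t and w may be replaced by their constant
    -- terms.
    obtain ⟨a, ha⟩ := exists_sub_mem_irr 𝒜 hzero (t : R)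
    obtain ⟨b, hb⟩ := exists_sub_mem_irr 𝒜 hzero w
    have ha0 : a ≠ 0 := by
      rintro rfl
      exact t.2 (by simpa using ha)
    have h2 : algebraMap k R a * v - algebraMap k R b * s ∈ I := by
      have h3 := I.add_mem (I.sub_mem h1 (hv _ ha)) (hs' _ hb)
      convert h3 using 1
      ring
    refine ⟨a⁻¹ * b, ?_⟩
    have h3 := I.mul_mem_left (algebraMap k R a⁻¹) h2
    rwa [mul_sub, ← mul_assoc, ← mul_assoc, ← map_mul, ← map_mul, inv_mul_cancel₀ ha0, map_one,
      one_mul] at h3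

end Localization

/-- The localization of `R` at the irrelevant ideal has finite injective dimension. -/
def IsLocallyGorenstein (𝒜 : ℕ → Submodule k R) [GradedAlgebra 𝒜] : Prop :=
  ∀ [(irr 𝒜).IsPrime], ∃ n : ℕ, HasInjectiveDimensionLE
    (ModuleCat.of (Localization.AtPrime (irr 𝒜)) (Localization.AtPrime (irr 𝒜))) n

/-- Noetherian induction on I. If R_+ is not associated to R/I, prime avoidance extends the regular
sequence; if it is, the socle lemma shows that I is already R_+-primary. -/
theorem IsRegularIdeal.exists_hasParameters [IsNoetherianRing R] [Nontrivial R] (hzero : 𝒜 0 = 1)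
    (hgor : IsLocallyGorenstein 𝒜) {n : ℕ} {I : Ideal R} (h : IsRegularIdeal 𝒜 n I) :
    ∃ c, HasParameters 𝒜 c I := by
  have hmax := irr_isMaximal 𝒜 hzero
  have hprime := hmax.isPrime
  induction I using WellFoundedGT.induction generalizing n with
  | _ I ih =>
  by_cases hass : IsAssociatedPrime (irr 𝒜) (R ⧸ I)
  · obtain ⟨-, z, hz⟩ := isAssociatedPrime_quotient_iff.1 hass
    refine ⟨0, .zero (h.socle hzero hgor (s := z) (fun hzI => ?_) fun y hy => (hz y).1 hy).1⟩
    exact one_notMem_irr 𝒜 ((hz 1).2 (by rwa [one_mul]))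
  · have hfin := associatedPrimes.finite R (R ⧸ I)
    obtain ⟨b, hb, x, hx, hxP⟩ := exists_pos_mem_forall_notMem 𝒜 hfin.toFinset
      (fun P hP => (hfin.mem_toFinset.1 hP).isPrime) (fun P hP hle => by
        have hP' : IsAssociatedPrime P (R ⧸ I) := hfin.mem_toFinset.1 hP
        rw [← hmax.eq_of_le hP'.isPrime.ne_top hle] at hP'
        exact hass hP')
    have hreg : ∀ y, x * y ∈ I → y ∈ I := by
      intro y hy
      by_contra hyI
      obtain ⟨P, hP, hP'⟩ := exists_isAssociatedPrime_of_notMem hyI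
      exact hxP P (hfin.mem_toFinset.2 hP) (hP' x hy)
    have hlt : I < I ⊔ Ideal.span {x} := by
      refine lt_of_le_of_ne le_sup_left fun heq => ?_
      have hxI : x ∈ I := heq ▸ Ideal.mem_sup_right (Ideal.mem_span_singleton_self x)
      exact one_notMem_irr 𝒜 (h.le_irr (hreg 1 (by rwa [mul_one])))
    obtain ⟨c, hc⟩ := ih _ hlt (.sup h hb hx hreg)
    exact ⟨c + 1, .succ hb hx hreg hc⟩

theorem IsRegularIdeal.hasParameters [IsNoetherianRing R] [Nontrivial R] (hzero : 𝒜 0 = 1)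
    (hgor : IsLocallyGorenstein 𝒜) {d : ℕ} (hd : ringKrullDim R = d) {n : ℕ} {I : Ideal R}
    (h : IsRegularIdeal 𝒜 n I) : ∃ c, n + c = d ∧ HasParameters 𝒜 c I := by
  obtain ⟨c, hc⟩ := h.exists_hasParameters hzero hgor
  refine ⟨c, ?_, hc⟩
  have := (hc.of_isRegularIdeal h).ringKrullDim_eq hzero
  rw [hd] at this
  exact_mod_cast this.symm

variable {d : ℕ} {b : Fin d → ℕ} {f : Fin d → R}

/-- If f i were a zerodivisor modulo the parameters in s, it would lie in an associated prime P with
dim R/P ≥ d - |s|. But P contains |s| + 1 of the parameters, so the remaining ones bound dim R/P by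
d - |s| - 1. -/
theorem IsHomogeneousParameters.isRegularIdeal_span_image [IsNoetherianRing R] [Nontrivial R]
    (hzero : 𝒜 0 = 1) (hgor : IsLocallyGorenstein 𝒜) (hf : IsHomogeneousParameters 𝒜 b f)
    (s : Finset (Fin d)) :
    IsRegularIdeal 𝒜 s.card (Ideal.span (f '' s)) ∧
      ∀ i ∉ s, ∀ y, f i * y ∈ Ideal.span (f '' s) → y ∈ Ideal.span (f '' s) := by
  have key : ∀ s : Finset (Fin d), IsRegularIdeal 𝒜 s.card (Ideal.span (f '' s)) →
      ∀ i ∉ s, ∀ y, f i * y ∈ Ideal.span (f '' s) → y ∈ Ideal.span (f '' s) := by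
    intro s h i hi y hy
    by_contra hyI
    obtain ⟨P, hP, hP'⟩ := exists_isAssociatedPrime_of_notMem hyI
    obtain ⟨c, hc, hpar⟩ := h.hasParameters hzero hgor hf.dim_eq
    have h1 := hpar.le_ringKrullDim h.isHomogeneous hP
    have hJ : (Ideal.span (f '' (insert i s : Finset (Fin d)))).IsHomogeneous 𝒜 :=
      Ideal.homogeneous_span 𝒜 _ (by
        rintro _ ⟨j, -, rfl⟩
        exact ⟨b j, hf.mem j⟩)
    have h2 := ringKrullDim_quotient_le_of_irr_le_radical 𝒜 hzero
      (ι := {j // j ∉ insert i s}) (g := fun j => f j) (b := fun j => b j)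
      (fun j => hf.pos j) (fun j => hf.mem j) hJ (hf.le_radical.trans (Ideal.radical_mono (by
        rw [Ideal.span_le]
        rintro _ ⟨j, rfl⟩
        by_cases hj : j ∈ insert i s
        · exact Ideal.mem_sup_left (Ideal.subset_span ⟨j, hj, rfl⟩)
        · exact Ideal.mem_sup_right (Ideal.subset_span ⟨⟨j, hj⟩, rfl⟩))))
    have hle : Ideal.span (f '' (insert i s : Finset (Fin d))) ≤ P := by
      rw [Ideal.span_le]
      rintro _ ⟨j, hj, rfl⟩
      rcases Finset.mem_insert.1 (Finset.mem_coe.1 hj) with rfl | hj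
      · exact hP' _ hy
      · exact hP' _ (Ideal.mul_mem_right _ _ (Ideal.subset_span ⟨j, hj, rfl⟩))
    have h3 := ringKrullDim_le_of_surjective (Ideal.Quotient.factor hle)
      (Ideal.Quotient.factor_surjective hle)
    have h4 : (c : WithBot ℕ∞) ≤ (Fintype.card {j // j ∉ insert i s} : ℕ) := h1.trans (h3.trans h2)
    have h5 : c ≤ Fintype.card {j // j ∉ insert i s} := by exact_mod_cast h4
    rw [Fintype.card_subtype_compl, Fintype.card_fin, Fintype.card_coe,
      Finset.card_insert_of_notMem hi] at h5
    have := Finset.card_le_univ (insert i s)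
    rw [Finset.card_insert_of_notMem hi, Fintype.card_fin] at this
    lia
  suffices h : IsRegularIdeal 𝒜 s.card (Ideal.span (f '' s)) from ⟨h, key s h⟩
  induction s using Finset.induction_on with
  | empty => simpa using IsRegularIdeal.bot
  | insert i s hi ih =>
    rw [Finset.card_insert_of_notMem hi, Finset.coe_insert, Set.image_insert_eq, Set.insert_eq,
      Ideal.span_union, sup_comm]
    exact .sup ih (hf.pos i) (hf.mem i) (key s ih i hi)

theorem IsHomogeneousParameters.exists [IsNoetherianRing R] [Nontrivial R]
    (hzero : 𝒜 0 = 1) (hgor : IsLocallyGorenstein 𝒜) (hd : ringKrullDim R = d) :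
    ∃ (b : Fin d → ℕ) (f : Fin d → R), IsHomogeneousParameters 𝒜 b f := by
  obtain ⟨c, hc, h⟩ := (IsRegularIdeal.bot (𝒜 := 𝒜)).hasParameters hzero hgor hd
  obtain rfl : c = d := by lia
  obtain ⟨g, b, hb, hg, hle⟩ := h.exists_family
  exact ⟨b, g, hd, hb, hg, by simpa using hle⟩

theorem IsHomogeneousParameters.pow (hf : IsHomogeneousParameters 𝒜 b f) {e : Fin d → ℕ}
    (he : ∀ i, 0 < e i) :
    IsHomogeneousParameters 𝒜 (fun i => e i * b i) (fun i => f i ^ e i) where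
  dim_eq := hf.dim_eq
  pos i := Nat.mul_pos (he i) (hf.pos i)
  mem i := SetLike.pow_mem_graded (e i) (hf.mem i)
  le_radical := by
    refine hf.le_radical.trans (Ideal.radical_le_radical_iff.2 ?_)
    rw [Ideal.span_le]
    rintro _ ⟨i, rfl⟩
    exact ⟨e i, Ideal.subset_span ⟨i, rfl⟩⟩

end GradedRing

/-! ### Numerical functions under division by 1 - X^b. -/

section Sequences

/-- `h' = (1 - X ^ b) * h` on generating functions. -/
def IsQuotientSeq (b : ℕ) (h h' : ℕ → ℕ) : Prop :=
  (∀ n < b, h n = h' n) ∧ ∀ n, h (b + n) = h' (b + n) + h n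

theorem IsQuotientSeq.sum_eq {b : ℕ} {h h' : ℕ → ℕ} (H : IsQuotientSeq b h h') (t : ℝ) (N : ℕ) :
    ∑ n ∈ Finset.range (b + N), (h n : ℝ) * t ^ n =
      ∑ n ∈ Finset.range (b + N), (h' n : ℝ) * t ^ n +
        t ^ b * ∑ n ∈ Finset.range N, (h n : ℝ) * t ^ n := by
  rw [Finset.sum_range_add, Finset.sum_range_add, add_assoc, Finset.mul_sum,
    ← Finset.sum_add_distrib]
  congr 1
  · exact Finset.sum_congr rfl fun n hn => by rw [H.1 n (Finset.mem_range.1 hn)]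
  · refine Finset.sum_congr rfl fun n _ => ?_
    rw [H.2 n, pow_add]
    push_cast
    ring

/-- The partial sums satisfy H(N) = H'(N) + H(N - b), and y^(c+1) + (c+1) b y^c ≤ (y + b)^(c+1)
carries the bound through the recursion with a shift of b. -/
theorem IsQuotientSeq.sum_le {b : ℕ} (hb : 0 < b) {h h' : ℕ → ℕ} (H : IsQuotientSeq b h h')
    {K B : ℝ} (hK : 0 ≤ K) (hB : 0 ≤ B) {c : ℕ}
    (hle : ∀ N : ℕ, ∑ n ∈ Finset.range (N + 1), (h' n : ℝ) ≤ K * (N + B) ^ c) (N : ℕ) :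
    ∑ n ∈ Finset.range (N + 1), (h n : ℝ) ≤ K / ((c + 1) * b) * (N + (B + b)) ^ (c + 1) := by
  have hb' : (0 : ℝ) < b := by exact_mod_cast hb
  have key : ∀ y : ℝ, 0 ≤ y →
      K * y ^ c + K / ((c + 1) * b) * y ^ (c + 1) ≤ K / ((c + 1) * b) * (y + b) ^ (c + 1) := by
    intro y hy
    have h1 : y ^ (c + 1) + (c + 1) * b * y ^ c ≤ (y + b) ^ (c + 1) := by
      have := pow_add_mul_le_add_pow (a := y) (b := (b : ℝ)) hy (by linarith) (c + 1)
      simpa [mul_assoc, mul_comm, mul_left_comm] using this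
    have h2 : K * y ^ c + K / ((c + 1) * b) * y ^ (c + 1) =
        K / ((c + 1) * b) * (y ^ (c + 1) + (c + 1) * b * y ^ c) := by
      field_simp
      ring
    rw [h2]
    exact mul_le_mul_of_nonneg_left h1 (by positivity)
  induction N using Nat.strong_induction_on with
  | _ N ih =>
    rcases lt_or_ge N b with hN | hN
    · have h1 : ∑ n ∈ Finset.range (N + 1), (h n : ℝ) = ∑ n ∈ Finset.range (N + 1), (h' n : ℝ) :=
        Finset.sum_congr rfl fun n hn => by
          rw [H.1 n (by have := Finset.mem_range.1 hn; lia)]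
      rw [h1]
      refine (hle N).trans ?_
      have := key (N + B) (by positivity)
      rw [← add_assoc]
      refine le_trans ?_ this
      have : 0 ≤ K / ((c + 1) * b) * (N + B) ^ (c + 1) := by positivity
      linarith
    · obtain ⟨M, rfl⟩ := Nat.exists_eq_add_of_le hN
      have h1 := H.sum_eq 1 (M + 1)
      simp only [one_pow, mul_one, one_mul] at h1
      rw [add_assoc, h1]
      have h2 := ih M (by lia)
      have h3 := hle (b + M)
      rw [add_assoc] at h3
      have h4 := key ((b + M : ℕ) + B) (by positivity)
      push_cast at h2 h3 h4 ⊢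
      rw [show (M : ℝ) + (B + b) = b + M + B by ring] at h2
      rw [show (b : ℝ) + M + (B + b) = b + M + B + b by ring]
      linarith

theorem IsQuotientSeq.summable {b : ℕ} (hb : 0 < b) {h h' : ℕ → ℕ} (H : IsQuotientSeq b h h')
    {t : ℝ} (ht : 0 ≤ t) (ht1 : t < 1) (hs : Summable fun n => (h' n : ℝ) * t ^ n) :
    Summable (fun n => (h n : ℝ) * t ^ n) ∧
      ∑' n, (h' n : ℝ) * t ^ n = (1 - t ^ b) * ∑' n, (h n : ℝ) * t ^ n := by
  have htb : t ^ b < 1 := pow_lt_one₀ ht ht1 hb.ne'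
  have hsum : Summable (fun n => (h n : ℝ) * t ^ n) := by
    refine summable_of_sum_range_le (c := (∑' n, (h' n : ℝ) * t ^ n) / (1 - t ^ b))
      (fun n => by positivity) fun N => ?_
    rw [le_div_iff₀ (by linarith)]
    have h1 := H.sum_eq t N
    have h2 : ∑ n ∈ Finset.range (b + N), (h' n : ℝ) * t ^ n ≤ ∑' n, (h' n : ℝ) * t ^ n :=
      hs.sum_le_tsum _ fun n _ => by positivity
    have h3 : ∑ n ∈ Finset.range N, (h n : ℝ) * t ^ n ≤
        ∑ n ∈ Finset.range (b + N), (h n : ℝ) * t ^ n :=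
      Finset.sum_le_sum_of_subset_of_nonneg (Finset.range_subset_range.2 (by lia))
        fun n _ _ => by positivity
    nlinarith
  refine ⟨hsum, ?_⟩
  have hlim : Tendsto (fun N => b + N) atTop atTop := tendsto_atTop_mono (fun N => Nat.le_add_left N b) tendsto_id
  have l1 := hsum.hasSum.tendsto_sum_nat.comp hlim
  have l2 := hs.hasSum.tendsto_sum_nat.comp hlim
  have l3 := hsum.hasSum.tendsto_sum_nat.const_mul (t ^ b)
  have l4 := l2.add l3
  have := tendsto_nhds_unique (l1.congr fun N => H.sum_eq t N) l4
  linarith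

variable {ι : Type*} [Fintype ι] [DecidableEq ι] {b : ι → ℕ} {h : Finset ι → ℕ → ℕ} {M : ℕ}

/-- The induction runs over complements: it starts from the finitely supported function at `univ`
and undoes one division at a time. -/
theorem sum_le_of_isQuotientSeq (hb : ∀ i, 0 < b i)
    (H : ∀ s, ∀ i ∉ s, IsQuotientSeq (b i) (h s) (h (insert i s)))
    (hM : ∀ n, M ≤ n → h Finset.univ n = 0) (N : ℕ) :
    ∑ n ∈ Finset.range (N + 1), (h ∅ n : ℝ) ≤
      (∑ n ∈ Finset.range M, (h Finset.univ n : ℝ)) /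
        ((Fintype.card ι)! * ∏ i, (b i : ℝ)) * (N + ∑ i, (b i : ℝ)) ^ Fintype.card ι := by
  set Q := ∑ n ∈ Finset.range M, (h Finset.univ n : ℝ)
  have hQ : 0 ≤ Q := by positivity
  have key : ∀ s : Finset ι, ∀ N : ℕ, ∑ n ∈ Finset.range (N + 1), (h sᶜ n : ℝ) ≤
      Q / (s.card ! * ∏ i ∈ s, (b i : ℝ)) * (N + ∑ i ∈ s, (b i : ℝ)) ^ s.card := by
    intro s
    induction s using Finset.induction_on with
    | empty =>
      intro N
      simp only [Finset.compl_empty, Finset.card_empty, pow_zero, mul_one, Nat.factorial_zero,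
        Nat.cast_one, Finset.prod_empty, div_one]
      have h1 : ∑ n ∈ Finset.range (N + 1), (h Finset.univ n : ℝ) ≤
          ∑ n ∈ Finset.range (M + (N + 1)), (h Finset.univ n : ℝ) :=
        Finset.sum_le_sum_of_subset_of_nonneg (Finset.range_subset_range.2 (by lia))
          fun n _ _ => by positivity
      rw [Finset.sum_range_add _ M] at h1
      have h2 : ∑ x ∈ Finset.range (N + 1), (h Finset.univ (M + x) : ℝ) = 0 :=
        Finset.sum_eq_zero fun x _ => by rw [hM _ (by lia)]; simp
      rw [h2, add_zero] at h1
      exact h1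
    | insert i s hi ih =>
      intro N
      have h1 := H (insert i s)ᶜ i (by simp)
      have h2 : insert i (insert i s)ᶜ = sᶜ := by
        ext j
        simp only [Finset.mem_insert, Finset.mem_compl]
        by_cases hj : j = i
        · subst hj; simp [hi]
        · simp [hj]
      rw [h2] at h1
      have h3 := h1.sum_le (hb i) (by positivity) (by positivity) ih N
      rw [Finset.card_insert_of_notMem hi, Finset.prod_insert hi, Finset.sum_insert hi,
        Nat.factorial_succ]
      refine h3.trans (le_of_eq ?_)
      rw [add_comm (b i : ℝ), div_div]
      push_cast
      congr 2
      ring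
  simpa using key Finset.univ N

theorem summable_of_isQuotientSeq (hb : ∀ i, 0 < b i)
    (H : ∀ s, ∀ i ∉ s, IsQuotientSeq (b i) (h s) (h (insert i s)))
    (hM : ∀ n, M ≤ n → h Finset.univ n = 0) {t : ℝ} (ht : 0 ≤ t) (ht1 : t < 1) :
    ∑ n ∈ Finset.range M, (h Finset.univ n : ℝ) * t ^ n =
      (∏ i, (1 - t ^ b i)) * ∑' n, (h ∅ n : ℝ) * t ^ n := by
  have key : ∀ s : Finset ι, Summable (fun n => (h sᶜ n : ℝ) * t ^ n) ∧
      ∑ n ∈ Finset.range M, (h Finset.univ n : ℝ) * t ^ n =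
        (∏ i ∈ s, (1 - t ^ b i)) * ∑' n, (h sᶜ n : ℝ) * t ^ n := by
    intro s
    induction s using Finset.induction_on with
    | empty =>
      have h0 : ∀ n ∉ Finset.range M, (h Finset.univ n : ℝ) * t ^ n = 0 := fun n hn => by
        rw [hM n (by simpa using hn)]; simp
      simp only [Finset.compl_empty, Finset.prod_empty, one_mul]
      exact ⟨summable_of_ne_finset_zero h0, (tsum_eq_sum h0).symm⟩
    | insert i s hi ih =>
      have h1 := H (insert i s)ᶜ i (by simp)
      have h2 : insert i (insert i s)ᶜ = sᶜ := by
        ext j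
        simp only [Finset.mem_insert, Finset.mem_compl]
        by_cases hj : j = i
        · subst hj; simp [hi]
        · simp [hj]
      rw [h2] at h1
      have h3 := h1.summable (hb i) ht ht1 ih.1
      refine ⟨h3.1, ?_⟩
      rw [ih.2, h3.2, Finset.prod_insert hi]
      ring
  simpa using (key Finset.univ).2

end Sequences

/-! ### Hilbert functions and the Poincaré series. -/

section Hilbert

variable {k : Type v} {R : Type u} [Field k] [CommRing R] [Algebra k R]
variable (𝒜 : ℕ → Submodule k R)

/-- The image of the component of degree `n` in `R ⧸ I`. -/
def quotComponent (I : Ideal R) (n : ℕ) : Submodule k (R ⧸ I) :=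
  (𝒜 n).map (Ideal.Quotient.mkₐ k I).toLinearMap

/-- The Hilbert function of `R ⧸ I`. -/
noncomputable def hilb (I : Ideal R) (n : ℕ) : ℕ := Module.finrank k (quotComponent 𝒜 I n)

theorem hilb_bot (n : ℕ) : hilb 𝒜 ⊥ n = Module.finrank k (𝒜 n) := by
  refine (LinearEquiv.finrank_eq (Submodule.equivMapOfInjective _ ?_ (𝒜 n))).symm
  intro x y hxy
  have h : Ideal.Quotient.mk (⊥ : Ideal R) x = Ideal.Quotient.mk ⊥ y := hxy
  rwa [Ideal.Quotient.eq, Ideal.mem_bot, sub_eq_zero] at h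

variable [GradedAlgebra 𝒜]

variable {𝒜} in
theorem finite_quotComponent [IsNoetherianRing R] (hzero : 𝒜 0 = 1) (I : Ideal R) (n : ℕ) :
    Module.Finite k (quotComponent 𝒜 I n) := by
  have := finite_component 𝒜 hzero n
  exact Module.Finite.map _ _

theorem hilb_eq_zero_iff [IsNoetherianRing R] (hzero : 𝒜 0 = 1) {I : Ideal R} {n : ℕ} :
    hilb 𝒜 I n = 0 ↔ ∀ r ∈ 𝒜 n, r ∈ I := by
  have := finite_quotComponent hzero I n
  rw [hilb, Submodule.finrank_eq_zero, quotComponent, eq_bot_iff, Submodule.map_le_iff_le_comap]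
  exact forall₂_congr fun r _ => Ideal.Quotient.eq_zero_iff_mem

/-- Dimension count in 0 → (R/I)_n → (R/I)_(b+n) → (R/(I + x))_(b+n) → 0, the first map being
multiplication by x. -/
theorem isQuotientSeq_hilb [IsNoetherianRing R] (hzero : 𝒜 0 = 1) {I : Ideal R}
    (hI : I.IsHomogeneous 𝒜) {b : ℕ} {x : R} (hx : x ∈ 𝒜 b) (hreg : ∀ y, x * y ∈ I → y ∈ I) :
    IsQuotientSeq b (hilb 𝒜 I) (hilb 𝒜 (I ⊔ Ideal.span {x})) := by
  have hfin := fun n => finite_quotComponent hzero I n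
  have hfac : ∀ n, ∀ y ∈ quotComponent 𝒜 I n,
      (Ideal.Quotient.factorₐ k (le_sup_left : I ≤ I ⊔ Ideal.span {x})).toLinearMap y ∈
        quotComponent 𝒜 (I ⊔ Ideal.span {x}) n := by
    rintro n _ ⟨r, hr, rfl⟩
    exact ⟨r, hr, rfl⟩
  let fac : ∀ n, quotComponent 𝒜 I n →ₗ[k] quotComponent 𝒜 (I ⊔ Ideal.span {x}) n := fun n =>
    LinearMap.restrict _ (hfac n)
  have hsurj : ∀ n, Function.Surjective (fac n) := by
    rintro n ⟨_, r, hr, rfl⟩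
    exact ⟨⟨_, r, hr, rfl⟩, rfl⟩
  have hker : ∀ n, ∀ r ∈ 𝒜 n, r ∈ I ⊔ Ideal.span {x} → ∃ j ∈ I, ∃ c, r = j + c * x ∧
      ((b ≤ n → c ∈ 𝒜 (n - b)) ∧ (n < b → c = 0)) := by
    intro n r hr hrI
    obtain ⟨j, hj, c, -, hc, hc'⟩ := exists_homogeneous_repr 𝒜 (ι := Unit) (g := fun _ => x)
      (b := fun _ => b) (fun _ => hx) hI hr (by rwa [Set.range_const])
    exact ⟨j, hj, c (), by simpa using hc, hc' ()⟩
  refine ⟨fun n hn => ?_, fun n => ?_⟩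
  · refine LinearEquiv.finrank_eq (LinearEquiv.ofBijective (fac n) ⟨?_, hsurj n⟩)
    rw [injective_iff_map_eq_zero]
    rintro ⟨_, r, hr, rfl⟩ h
    have h1 : Ideal.Quotient.mk (I ⊔ Ideal.span {x}) r = 0 := congrArg Subtype.val h
    obtain ⟨j, hj, c, hc, -, hc'⟩ := hker n r hr (Ideal.Quotient.eq_zero_iff_mem.1 h1)
    rw [hc' hn, zero_mul, add_zero] at hc
    exact Subtype.ext (Ideal.Quotient.eq_zero_iff_mem.2 (hc ▸ hj))
  · have hmul : ∀ y ∈ quotComponent 𝒜 I n,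
        (LinearMap.mulLeft k (Ideal.Quotient.mk I x)) y ∈ quotComponent 𝒜 I (b + n) := by
      rintro _ ⟨r, hr, rfl⟩
      exact ⟨x * r, SetLike.GradedMul.mul_mem hx hr, rfl⟩
    let mul : quotComponent 𝒜 I n →ₗ[k] quotComponent 𝒜 I (b + n) := LinearMap.restrict _ hmul
    have hinj : Function.Injective mul := by
      rw [injective_iff_map_eq_zero]
      rintro ⟨_, r, hr, rfl⟩ h
      have h1 : Ideal.Quotient.mk I (x * r) = 0 := congrArg Subtype.val h
      exact Subtype.ext (Ideal.Quotient.eq_zero_iff_mem.2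
        (hreg r (Ideal.Quotient.eq_zero_iff_mem.1 h1)))
    have hex : LinearMap.ker (fac (b + n)) = LinearMap.range mul := by
      ext ⟨y, hy⟩
      constructor
      · intro h
        obtain ⟨r, hr, rfl⟩ := hy
        have h1 : Ideal.Quotient.mk (I ⊔ Ideal.span {x}) r = 0 :=
          congrArg Subtype.val (LinearMap.mem_ker.1 h)
        obtain ⟨j, hj, c, rfl, hc, -⟩ := hker _ r hr (Ideal.Quotient.eq_zero_iff_mem.1 h1)
        have hc' := hc (by lia)
        rw [Nat.add_sub_cancel_left] at hc'
        refine ⟨⟨_, c, hc', rfl⟩, Subtype.ext ?_⟩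
        change Ideal.Quotient.mk I (x * c) = Ideal.Quotient.mk I (j + c * x)
        rw [map_add, Ideal.Quotient.eq_zero_iff_mem.2 hj, zero_add, mul_comm]
      · rintro ⟨⟨_, r, hr, rfl⟩, h⟩
        have h1 : Ideal.Quotient.mk I (x * r) = y := congrArg Subtype.val h
        refine Subtype.ext ?_
        change Ideal.Quotient.factor (le_sup_left : I ≤ I ⊔ Ideal.span {x}) y = 0
        rw [← h1, Ideal.Quotient.factor_mk, Ideal.Quotient.eq_zero_iff_mem]
        exact Ideal.mem_sup_right (Ideal.mul_mem_right _ _ (Ideal.mem_span_singleton_self x))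
    have h1 := LinearMap.finrank_range_add_finrank_ker (fac (b + n))
    rw [LinearMap.range_eq_top.2 (hsurj _), finrank_top, hex,
      LinearMap.finrank_range_of_inj hinj] at h1
    exact h1.symm

variable {𝒜} {d : ℕ} {b : Fin d → ℕ} {f : Fin d → R}

theorem IsHomogeneousParameters.isQuotientSeq [IsNoetherianRing R] [Nontrivial R]
    (hzero : 𝒜 0 = 1) (hgor : IsLocallyGorenstein 𝒜) (hf : IsHomogeneousParameters 𝒜 b f)
    (s : Finset (Fin d)) (i : Fin d) (hi : i ∉ s) :
    IsQuotientSeq (b i) (hilb 𝒜 (Ideal.span (f '' s)))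
      (hilb 𝒜 (Ideal.span (f '' (insert i s : Finset (Fin d))))) := by
  obtain ⟨h1, h2⟩ := hf.isRegularIdeal_span_image hzero hgor s
  rw [Finset.coe_insert, Set.image_insert_eq, Set.insert_eq, Ideal.span_union, sup_comm]
  exact isQuotientSeq_hilb 𝒜 hzero h1.isHomogeneous (hf.mem i) (h2 i hi)

open Polynomial in
/-- The Poincaré polynomial of the quotient by a homogeneous system of parameters. -/
theorem IsHomogeneousParameters.exists_polynomial [IsNoetherianRing R] [Nontrivial R]
    (hzero : 𝒜 0 = 1) (hgor : IsLocallyGorenstein 𝒜) (hf : IsHomogeneousParameters 𝒜 b f) :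
    ∃ Q : ℝ[X], (∀ n, Q.coeff n = hilb 𝒜 (Ideal.span (Set.range f)) n) ∧
      (∀ t : ℝ, 0 ≤ t → t < 1 →
        Q.eval t = (∏ i, (1 - t ^ b i)) * poincareSeries 𝒜 t) ∧
      ∀ N : ℕ, ∑ n ∈ Finset.range (N + 1), (Module.finrank k (𝒜 n) : ℝ) ≤
        Q.eval 1 / (d ! * ∏ i, (b i : ℝ)) * (N + ∑ i, (b i : ℝ)) ^ d := by
  obtain ⟨M, hM⟩ := exists_forall_le_of_irr_le_radical 𝒜 hf.le_radical
  have hM' : ∀ n, M ≤ n → hilb 𝒜 (Ideal.span (f '' (Finset.univ : Finset (Fin d)))) n = 0 :=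
    fun n hn => by
      rw [hilb_eq_zero_iff 𝒜 hzero]
      simpa using hM n hn
  let h : Finset (Fin d) → ℕ → ℕ := fun s => hilb 𝒜 (Ideal.span (f '' s))
  have H : ∀ s, ∀ i ∉ s, IsQuotientSeq (b i) (h s) (h (insert i s)) := fun s i hi =>
    hf.isQuotientSeq hzero hgor s i hi
  have huniv : h Finset.univ = hilb 𝒜 (Ideal.span (Set.range f)) := by
    simp only [h, Finset.coe_univ, Set.image_univ]
  have hempty : ∀ n, h ∅ n = Module.finrank k (𝒜 n) := fun n => by
    simp only [h, Finset.coe_empty, Set.image_empty, Ideal.span_empty, hilb_bot]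
  refine ⟨∑ n ∈ Finset.range M, Polynomial.monomial n
    (hilb 𝒜 (Ideal.span (Set.range f)) n : ℝ), fun n => ?_, fun t ht ht1 => ?_, fun N => ?_⟩
  · simp only [Polynomial.finsetSum_coeff, Polynomial.coeff_monomial, Finset.sum_ite_eq',
      Finset.mem_range]
    split_ifs with hn
    · rfl
    · have := hM' n (by lia)
      simp only [Finset.coe_univ, Set.image_univ] at this
      rw [this, Nat.cast_zero]
  · have := summable_of_isQuotientSeq hf.pos H hM' ht ht1
    simp only [huniv, hempty] at this
    rw [Polynomial.eval_finsetSum]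
    simp only [Polynomial.eval_monomial]
    exact this
  · have := sum_le_of_isQuotientSeq hf.pos H hM' N
    simp only [huniv, hempty, Fintype.card_fin] at this
    rw [Polynomial.eval_finsetSum]
    simp only [Polynomial.eval_monomial, one_pow, mul_one]
    exact this

open Polynomial in
-- The degree of the Poincaré series as a rational function, deg Q - Σ b, does not depend on the
-- parameters; it will be the a-invariant.
theorem natDegree_add_eq_of_eval_eq {d d' : ℕ} {b : Fin d → ℕ} {b' : Fin d' → ℕ} {Q Q' : ℝ[X]}
    (hQ : Q ≠ 0) (hQ' : Q' ≠ 0) (hb : ∀ i, 0 < b i) (hb' : ∀ i, 0 < b' i) {P : ℝ → ℝ}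
    (h : ∀ t : ℝ, 0 ≤ t → t < 1 → Q.eval t = (∏ i, (1 - t ^ b i)) * P t)
    (h' : ∀ t : ℝ, 0 ≤ t → t < 1 → Q'.eval t = (∏ i, (1 - t ^ b' i)) * P t) :
    Q.natDegree + ∑ i, b' i = Q'.natDegree + ∑ i, b i := by
  have hprod : ∀ {d : ℕ} (b : Fin d → ℕ), (∀ i, 0 < b i) →
      (∏ i, (1 - X ^ b i) : ℝ[X]) ≠ 0 ∧ (∏ i, (1 - X ^ b i) : ℝ[X]).natDegree = ∑ i, b i := by
    intro d b hb
    have hdeg : ∀ i, (1 - X ^ b i : ℝ[X]).natDegree = b i := fun i => by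
      rw [← neg_sub, natDegree_neg, ← C_1, natDegree_X_pow_sub_C]
    have hne : ∀ i, (1 - X ^ b i : ℝ[X]) ≠ 0 := fun i h0 => by
      have := hdeg i
      rw [h0, natDegree_zero] at this
      exact (hb i).ne this
    refine ⟨Finset.prod_ne_zero_iff.2 fun i _ => hne i, ?_⟩
    rw [natDegree_prod _ _ fun i _ => hne i]
    exact Finset.sum_congr rfl fun i _ => hdeg i
  have heq : Q * ∏ i, (1 - X ^ b' i) = Q' * ∏ i, (1 - X ^ b i) := by
    refine eq_of_infinite_eval_eq _ _ ((Set.Ico_infinite (zero_lt_one' ℝ)).mono ?_)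
    rintro t ⟨ht, ht1⟩
    simp only [Set.mem_ofPred_eq, eval_mul, eval_prod, eval_sub, eval_one, eval_pow, eval_X,
      h t ht ht1, h' t ht ht1]
    ring
  have := congrArg natDegree heq
  rwa [natDegree_mul hQ (hprod b' hb').1, natDegree_mul hQ' (hprod b hb).1, (hprod b' hb').2,
    (hprod b hb).2] at this

open Polynomial in
theorem tendsto_of_eval_eq {d : ℕ} {b : Fin d → ℕ} {Q : ℝ[X]} (hb : ∀ i, 0 < b i) {P : ℝ → ℝ}
    (h : ∀ t : ℝ, 0 ≤ t → t < 1 → Q.eval t = (∏ i, (1 - t ^ b i)) * P t) :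
    Tendsto (fun t : ℝ => (1 - t) ^ d * P t) (𝓝[<] 1) (𝓝 (Q.eval 1 / ∏ i, (b i : ℝ))) := by
  have hcont : ContinuousAt (fun t : ℝ => Q.eval t / ∏ i, ∑ j ∈ Finset.range (b i), t ^ j) 1 := by
    refine ContinuousAt.div Q.continuous.continuousAt (by fun_prop) ?_
    simp only [one_pow, Finset.sum_const, Finset.card_range, nsmul_eq_mul, mul_one]
    exact Finset.prod_ne_zero_iff.2 fun i _ => by exact_mod_cast (hb i).ne'
  have hlim := hcont.tendsto.mono_left (nhdsWithin_le_nhds (s := Set.Iio 1))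
  simp only [one_pow, Finset.sum_const, Finset.card_range, nsmul_eq_mul, mul_one] at hlim
  refine hlim.congr' ?_
  have hmem : Set.Ioo (0 : ℝ) 1 ∈ 𝓝[<] (1 : ℝ) := Ioo_mem_nhdsLT one_pos
  filter_upwards [hmem] with t ht
  have hpos : ∀ i, 0 < ∑ j ∈ Finset.range (b i), t ^ j := fun i =>
    Finset.sum_pos (fun j _ => pow_pos ht.1 j) ⟨0, Finset.mem_range.2 (hb i)⟩
  rw [h t ht.1.le ht.2, div_eq_iff (Finset.prod_ne_zero_iff.2 fun i _ => (hpos i).ne')]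
  have : ∀ i, 1 - t ^ b i = (1 - t) * ∑ j ∈ Finset.range (b i), t ^ j := fun i =>
    (mul_neg_geom_sum t (b i)).symm
  simp only [this, Finset.prod_mul_distrib, Finset.prod_const, Finset.card_univ, Fintype.card_fin]
  ring

end Hilbert

/-! ### Top degrees of parameter quotients and Čech cohomology. -/

section TopDegree

variable {k : Type v} {R : Type u} [Field k] [CommRing R] [Algebra k R]

/-- `R ⧸ I` is nonzero in degree `σ` and zero in higher degrees. -/
def IsTopDegree (𝒜 : ℕ → Submodule k R) (I : Ideal R) (σ : ℕ) : Prop :=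
  (∃ u ∈ 𝒜 σ, u ∉ I) ∧ ∀ n, σ < n → ∀ r ∈ 𝒜 n, r ∈ I

variable {𝒜 : ℕ → Submodule k R} [GradedAlgebra 𝒜] {d : ℕ} {b : Fin d → ℕ} {f : Fin d → R}

theorem IsHomogeneousParameters.span_le_irr (hf : IsHomogeneousParameters 𝒜 b f) :
    Ideal.span (Set.range f) ≤ irr 𝒜 := by
  rw [Ideal.span_le]
  rintro _ ⟨i, rfl⟩
  exact mem_irr_of_mem 𝒜 (hf.pos i) (hf.mem i)

theorem IsHomogeneousParameters.isHomogeneous (hf : IsHomogeneousParameters 𝒜 b f) :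
    (Ideal.span (Set.range f)).IsHomogeneous 𝒜 :=
  Ideal.homogeneous_span 𝒜 _ (by rintro _ ⟨i, rfl⟩; exact ⟨b i, hf.mem i⟩)

open Polynomial in
theorem isTopDegree_natDegree [IsNoetherianRing R] [Nontrivial R] (hzero : 𝒜 0 = 1)
    {I : Ideal R} (hI : I ≤ irr 𝒜) {Q : ℝ[X]} (hQ : ∀ n, Q.coeff n = hilb 𝒜 I n) :
    Q ≠ 0 ∧ IsTopDegree 𝒜 I Q.natDegree := by
  have hQ0 : Q ≠ 0 := by
    rintro rfl
    have h := hQ 0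
    rw [coeff_zero] at h
    have h1 := (hilb_eq_zero_iff 𝒜 hzero (I := I) (n := 0)).1 (by exact_mod_cast h.symm) 1
      SetLike.GradedOne.one_mem
    exact one_notMem_irr 𝒜 (hI h1)
  refine ⟨hQ0, ?_, fun n hn => ?_⟩
  · by_contra! hcon
    have h1 := (hilb_eq_zero_iff 𝒜 hzero).2 hcon
    have h2 := hQ Q.natDegree
    rw [h1, Nat.cast_zero, coeff_natDegree, leadingCoeff_eq_zero] at h2
    exact hQ0 h2
  · refine (hilb_eq_zero_iff 𝒜 hzero).1 ?_
    have h1 := hQ n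
    rw [coeff_eq_zero_of_natDegree_lt hn] at h1
    exact_mod_cast h1.symm

/-- The integer that turns out to be the a-invariant, together with the numerical data of a
homogeneous system of parameters. -/
theorem exists_aInvariant_data [IsNoetherianRing R] [Nontrivial R] (hzero : 𝒜 0 = 1)
    (hgor : IsLocallyGorenstein 𝒜) (hf : IsHomogeneousParameters 𝒜 b f) :
    ∃ (a : ℤ) (e' : ℝ), 0 ≤ e' ∧
      (∀ (b' : Fin d → ℕ) (f' : Fin d → R), IsHomogeneousParameters 𝒜 b' f' →
        ∃ σ : ℕ, (σ : ℤ) = a + ∑ i, (b' i : ℤ) ∧ IsTopDegree 𝒜 (Ideal.span (Set.range f')) σ) ∧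
      Tendsto (fun t : ℝ => (1 - t) ^ d * poincareSeries 𝒜 t) (𝓝[<] 1) (𝓝 e') ∧
      ∀ N : ℕ, ∑ n ∈ Finset.range (N + 1), (Module.finrank k (𝒜 n) : ℝ) ≤
        e' / d ! * (N + ∑ i, (b i : ℝ)) ^ d := by
  obtain ⟨Q, hQ, hQt, hQN⟩ := hf.exists_polynomial hzero hgor
  have hpos : 0 < ∏ i, (b i : ℝ) := Finset.prod_pos fun i _ => by exact_mod_cast hf.pos i
  refine ⟨Q.natDegree - ∑ i, (b i : ℤ), Q.eval 1 / ∏ i, (b i : ℝ), div_nonneg ?_ hpos.le,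
    fun b' f' hf' => ?_, tendsto_of_eval_eq hf.pos hQt, fun N => ?_⟩
  · rw [Polynomial.eval_eq_sum_range]
    refine Finset.sum_nonneg fun i _ => ?_
    rw [hQ]
    positivity
  · obtain ⟨Q', hQ', hQt', -⟩ := hf'.exists_polynomial hzero hgor
    obtain ⟨h1, -⟩ := isTopDegree_natDegree hzero hf.span_le_irr hQ
    obtain ⟨h2, h3⟩ := isTopDegree_natDegree hzero hf'.span_le_irr hQ'
    refine ⟨Q'.natDegree, ?_, h3⟩
    have h4 := natDegree_add_eq_of_eval_eq h1 h2 hf.pos hf'.pos hQt hQt'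
    have h5 : (Q.natDegree : ℤ) + ∑ i, (b' i : ℤ) = Q'.natDegree + ∑ i, (b i : ℤ) := by
      exact_mod_cast h4
    lia
  · refine (hQN N).trans (le_of_eq ?_)
    rw [div_div, mul_comm (d ! : ℝ)]

/-- This is injectivity of R/(f) → R/(f_i^(L+1)) under multiplication by (∏ f)^L. One index at a
time, the factor f_i^L is cancelled and the exponent of f_i drops from L + 1 to 1. -/
theorem IsHomogeneousParameters.pow_mul_mem_span_pow [IsNoetherianRing R] [Nontrivial R]
    (hzero : 𝒜 0 = 1) (hgor : IsLocallyGorenstein 𝒜) (hf : IsHomogeneousParameters 𝒜 b f)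
    {L : ℕ} (hL : 0 < L) {u : R}
    (hu : (∏ i, f i) ^ L * u ∈ Ideal.span (Set.range fun i => f i ^ (L + 1))) :
    u ∈ Ideal.span (Set.range f) := by
  have key : ∀ s : Finset (Fin d), (∏ i ∈ sᶜ, f i ^ L) * u ∈
      Ideal.span (Set.range fun i => f i ^ (if i ∈ s then 1 else L + 1)) := by
    intro s
    induction s using Finset.induction_on with
    | empty => simpa [Finset.prod_pow] using hu
    | insert i s hi ih =>
      have h1 : sᶜ = insert i (insert i s)ᶜ := by
        ext j
        simp only [Finset.mem_insert, Finset.mem_compl]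
        by_cases hj : j = i
        · subst hj; simp [hi]
        · simp [hj]
      rw [h1, Finset.prod_insert (by simp), mul_assoc] at ih
      set y := (∏ i ∈ (insert i s)ᶜ, f i ^ L) * u
      obtain ⟨c, hc⟩ := Ideal.mem_span_range_iff_exists_fun.1 ih
      rw [← Finset.add_sum_erase _ _ (Finset.mem_univ i), if_neg hi] at hc
      -- The exponent L at i makes f_i^L regular modulo the other powers.
      have hf' := hf.pow (e := fun j => if j = i then L else if j ∈ s then 1 else L + 1)
        (fun j => by split_ifs <;> lia)
      have hreg := (hf'.isRegularIdeal_span_image hzero hgor (Finset.univ.erase i)).2 i (by simp)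
        (y - c i * f i)
      simp only [if_true] at hreg
      have hmem : ∀ (c : Fin d → R), ∑ j ∈ Finset.univ.erase i,
          c j * f j ^ (if j ∈ s then 1 else L + 1) ∈ Ideal.span
            ((fun j => f j ^ (if j = i then L else if j ∈ s then 1 else L + 1)) ''
              (Finset.univ.erase i : Finset (Fin d))) := fun c =>
        Ideal.sum_mem _ fun j hj => Ideal.mul_mem_left _ _ (Ideal.subset_span
          ⟨j, hj, by simp only [if_neg (Finset.ne_of_mem_erase hj)]⟩)
      have h2 := hreg (by
        convert hmem c using 1
        rw [mul_sub, ← hc]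
        ring)
      have hle : Ideal.span
            ((fun j => f j ^ (if j = i then L else if j ∈ s then 1 else L + 1)) ''
              (Finset.univ.erase i : Finset (Fin d))) ≤
          Ideal.span (Set.range fun j => f j ^ (if j ∈ insert i s then 1 else L + 1)) := by
        rw [Ideal.span_le]
        rintro _ ⟨j, hj, rfl⟩
        have hj' := Finset.ne_of_mem_erase hj
        refine Ideal.subset_span ⟨j, ?_⟩
        simp [hj']
      have h3 : f i ∈ Ideal.span (Set.range fun j => f j ^ (if j ∈ insert i s then 1 else L + 1)) :=
        Ideal.subset_span ⟨i, by simp⟩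
      have h4 := Ideal.add_mem _ (hle h2) (Ideal.mul_mem_left _ (c i) h3)
      rwa [sub_add_cancel] at h4
  simpa using key Finset.univ

end TopDegree

section Cech

variable {R : Type u} [CommRing R] {d : ℕ} (f : Fin d → R)

theorem algebraMap_pow_mul_cechMap (i : Fin d) (c : R) (M : ℕ)
    (h : (∏ j ∈ Finset.univ.erase i, f j) ^ M ∈ Submonoid.powers (∏ j ∈ Finset.univ.erase i, f j)) :
    algebraMap R (Localization.Away (∏ j, f j)) ((∏ j, f j) ^ M) *
      cechMap f i (Localization.mk c ⟨(∏ j ∈ Finset.univ.erase i, f j) ^ M, h⟩) =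
      algebraMap R _ (c * f i ^ M) := by
  have hlift : ∀ r, cechMap f i (algebraMap R _ r) = algebraMap R _ r := fun r =>
    IsLocalization.Away.lift_eq _ (isUnit_prod_erase f i) r
  have hP : (∏ j, f j) ^ M = (∏ j ∈ Finset.univ.erase i, f j) ^ M * f i ^ M := by
    rw [← Finset.mul_prod_erase _ _ (Finset.mem_univ i), mul_pow, mul_comm]
  have hc : cechMap f i (algebraMap R _ ((∏ j ∈ Finset.univ.erase i, f j) ^ M)) *
      cechMap f i (Localization.mk c ⟨(∏ j ∈ Finset.univ.erase i, f j) ^ M, h⟩) =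
        cechMap f i (algebraMap R _ c) := by
    rw [← map_mul, Localization.mk_eq_mk', IsLocalization.mk'_spec'_mk]
  rw [hlift, hlift] at hc
  rw [congrArg (algebraMap R (Localization.Away (∏ j, f j))) hP, map_mul, map_mul, ← hc]
  ring

theorem isUnit_algebraMap_prod_pow (M : ℕ) :
    IsUnit (algebraMap R (Localization.Away (∏ j, f j)) ((∏ j, f j) ^ M)) := by
  rw [map_pow]
  exact (IsLocalization.Away.algebraMap_isUnit (∏ j, f j)).pow M

theorem algebraMap_pow_mul_mk (r : R) (M : ℕ)
    (h : (∏ j, f j) ^ M ∈ Submonoid.powers (∏ j, f j)) :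
    algebraMap R (Localization.Away (∏ j, f j)) ((∏ j, f j) ^ M) *
      Localization.mk r ⟨(∏ j, f j) ^ M, h⟩ = algebraMap R _ r := by
  rw [Localization.mk_eq_mk', IsLocalization.mk'_spec'_mk]

theorem cechMap_mem_cechBoundary (i : Fin d)
    (x : Localization.Away (∏ j ∈ Finset.univ.erase i, f j)) : cechMap f i x ∈ cechBoundary f :=
  Submodule.mem_iSup_of_mem i (Submodule.subset_span ⟨x, rfl⟩)

theorem mem_cechBoundary_of_mem_span {r : R} {M : ℕ}
    (hr : r ∈ Ideal.span (Set.range fun i => f i ^ M)) {y : Localization.Away (∏ j, f j)}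
    (hy : algebraMap R _ ((∏ j, f j) ^ M) * y = algebraMap R _ r) : y ∈ cechBoundary f := by
  obtain ⟨c, rfl⟩ := Ideal.mem_span_range_iff_exists_fun.1 hr
  have h : y = ∑ i, cechMap f i (Localization.mk (c i)
      ⟨(∏ j ∈ Finset.univ.erase i, f j) ^ M, pow_mem (Submonoid.mem_powers _) M⟩) := by
    refine (isUnit_algebraMap_prod_pow f M).mul_left_cancel ?_
    rw [hy, Finset.mul_sum, map_sum]
    exact Finset.sum_congr rfl fun i _ => (algebraMap_pow_mul_cechMap f i (c i) M _).symm
  rw [h]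
  exact Submodule.sum_mem _ fun i _ => cechMap_mem_cechBoundary f i _

theorem prod_pow_mul_mem_span {z : R} {M : ℕ}
    (hz : z ∈ Ideal.span (Set.range fun i => f i ^ M)) (L : ℕ) :
    (∏ j, f j) ^ L * z ∈ Ideal.span (Set.range fun i => f i ^ (L + M)) := by
  obtain ⟨c, rfl⟩ := Ideal.mem_span_range_iff_exists_fun.1 hz
  rw [Finset.mul_sum]
  refine Ideal.sum_mem _ fun i _ => ?_
  have h : (∏ j, f j) ^ L * (c i * f i ^ M) =
      ((∏ j ∈ Finset.univ.erase i, f j) ^ L * c i) * f i ^ (L + M) := by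
    rw [← Finset.mul_prod_erase _ _ (Finset.mem_univ i), mul_pow]
    ring
  rw [h]
  exact Ideal.mul_mem_left _ _ (Ideal.subset_span ⟨i, rfl⟩)

/-- With `mem_cechBoundary_of_mem_span`, this describes the boundaries as the fractions z/(∏ f)^M
with z in the ideal of the f_i^M. -/
theorem exists_mem_span_of_mem_cechBoundary {y : Localization.Away (∏ j, f j)}
    (hy : y ∈ cechBoundary f) :
    ∃ M, ∃ z ∈ Ideal.span (Set.range fun i => f i ^ M),
      algebraMap R _ ((∏ j, f j) ^ M) * y = algebraMap R _ z := by
  have hadd : ∀ y₁ y₂ : Localization.Away (∏ j, f j),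
      (∃ M, ∃ z ∈ Ideal.span (Set.range fun i => f i ^ M),
        algebraMap R _ ((∏ j, f j) ^ M) * y₁ = algebraMap R _ z) →
      (∃ M, ∃ z ∈ Ideal.span (Set.range fun i => f i ^ M),
        algebraMap R _ ((∏ j, f j) ^ M) * y₂ = algebraMap R _ z) →
      ∃ M, ∃ z ∈ Ideal.span (Set.range fun i => f i ^ M),
        algebraMap R _ ((∏ j, f j) ^ M) * (y₁ + y₂) = algebraMap R _ z := by
    rintro y₁ y₂ ⟨M₁, z₁, hz₁, h₁⟩ ⟨M₂, z₂, hz₂, h₂⟩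
    refine ⟨M₁ + M₂, (∏ j, f j) ^ M₂ * z₁ + (∏ j, f j) ^ M₁ * z₂, Ideal.add_mem _ ?_
      (prod_pow_mul_mem_span f hz₂ M₁), ?_⟩
    · rw [add_comm M₁]
      exact prod_pow_mul_mem_span f hz₁ M₂
    · rw [map_add, map_mul, map_mul, ← h₁, ← h₂, pow_add, map_mul]
      ring
  have hzero : ∃ M, ∃ z ∈ Ideal.span (Set.range fun i => f i ^ M),
      algebraMap R _ ((∏ j, f j) ^ M) * (0 : Localization.Away (∏ j, f j)) = algebraMap R _ z :=
    ⟨0, 0, zero_mem _, by simp⟩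
  refine Submodule.iSup_induction _ (motive := fun y => ∃ M, ∃ z ∈ Ideal.span (Set.range fun i => f i ^ M),
      algebraMap R _ ((∏ j, f j) ^ M) * y = algebraMap R _ z) hy (fun i x hx => ?_) hzero hadd
  induction hx using Submodule.span_induction with
  | mem x hx =>
    obtain ⟨w, rfl⟩ := hx
    induction w using Localization.induction_on with
    | H w =>
      obtain ⟨c, _, M, rfl⟩ := w
      exact ⟨M, c * f i ^ M, Ideal.mul_mem_left _ _ (Ideal.subset_span ⟨i, rfl⟩),
        algebraMap_pow_mul_cechMap f i c M _⟩
  | zero => exact hzero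
  | add x y _ _ hx hy => exact hadd x y hx hy
  | smul r x _ hx =>
    obtain ⟨M, z, hz, h⟩ := hx
    refine ⟨M, r * z, Ideal.mul_mem_left _ _ hz, ?_⟩
    rw [mul_smul_comm, h, Algebra.smul_def, map_mul]

variable {f}

theorem exists_pow_mul_mem_span_of_mk_mem_cechBoundary {u : R}
    (h : Localization.mk u ⟨(∏ j, f j) ^ 1, pow_mem (Submonoid.mem_powers _) 1⟩ ∈
      cechBoundary f) :
    ∃ L, 0 < L ∧ (∏ j, f j) ^ L * u ∈ Ideal.span (Set.range fun i => f i ^ (L + 1)) := by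
  obtain ⟨M, z, hz, hM⟩ := exists_mem_span_of_mem_cechBoundary f h
  have h1 := congrArg (algebraMap R (Localization.Away (∏ j, f j)) ((∏ j, f j) ^ 1) * ·) hM
  rw [mul_left_comm, algebraMap_pow_mul_mk, ← map_mul, ← map_mul] at h1
  obtain ⟨⟨_, K, rfl⟩, hK⟩ := (IsLocalization.eq_iff_exists (Submonoid.powers (∏ j, f j)) _).1 h1
  simp only at hK
  refine ⟨K + 1 + M, by lia, ?_⟩
  have h2 : (∏ j, f j) ^ (K + 1 + M) * u = (∏ j, f j) ^ (K + 2) * z := by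
    calc _ = (∏ j, f j) * ((∏ j, f j) ^ K * ((∏ j, f j) ^ M * u)) := by ring
      _ = _ := by rw [hK]; ring
  rw [h2, show K + 1 + M + 1 = K + 2 + M by ring]
  exact prod_pow_mul_mem_span f hz _

end Cech

section AInvariant

variable {k : Type v} {R : Type u} [Field k] [CommRing R] [Algebra k R]
variable {𝒜 : ℕ → Submodule k R} [GradedAlgebra 𝒜] {d : ℕ} {b : Fin d → ℕ} {f : Fin d → R}

theorem isAInvariant_of_isTopDegree [IsNoetherianRing R] [Nontrivial R] (hzero : 𝒜 0 = 1)
    (hgor : IsLocallyGorenstein 𝒜) (hf : IsHomogeneousParameters 𝒜 b f) {a : ℤ}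
    (ha : ∀ (b' : Fin d → ℕ) (f' : Fin d → R), IsHomogeneousParameters 𝒜 b' f' →
      ∃ σ : ℕ, (σ : ℤ) = a + ∑ i, (b' i : ℤ) ∧ IsTopDegree 𝒜 (Ideal.span (Set.range f')) σ) :
    IsAInvariant 𝒜 d a := by
  refine ⟨⟨b, f, hf, ?_⟩, ?_⟩
  · obtain ⟨σ, hσ, ⟨u, hu, hu'⟩, -⟩ := ha b f hf
    rw [Submodule.ne_bot_iff]
    -- The class of u/∏ f, with u nonzero in the top degree of R/(f), survives in degree a.
    refine ⟨_, Submodule.subset_span ⟨1, σ, u, hu, by simpa using hσ, rfl⟩, fun h0 => ?_⟩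
    rw [Submodule.mkQ_apply, Submodule.Quotient.mk_eq_zero] at h0
    obtain ⟨L, hL, h⟩ := exists_pow_mul_mem_span_of_mk_mem_cechBoundary h0
    exact hu' (hf.pow_mul_mem_span_pow hzero hgor hL h)
  · rintro n ⟨b', f', hf', hn⟩
    by_contra! hlt
    refine hn (Submodule.span_eq_bot.2 ?_)
    rintro _ ⟨N, m, r, hr, hm, rfl⟩
    obtain ⟨σ, hσ, -, htop⟩ := ha _ _ (hf'.pow (e := fun _ => N + 1) fun _ => N.succ_pos)
    rw [Submodule.mkQ_apply, Submodule.Quotient.mk_eq_zero]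
    have hprod : ∏ j, f' j ∈ 𝒜 (∑ j, b' j) := SetLike.prod_mem_graded _ _ _ fun i _ => hf'.mem i
    -- Rewrite r/(∏ f)^N as r ∏ f/(∏ f)^(N+1), which keeps the exponent positive when N = 0. For n >
    -- a the numerator lies above the top degree modulo the f_i^(N+1).
    refine mem_cechBoundary_of_mem_span f' (M := N + 1)
      (htop (m + ∑ j, b' j) ?_ (r * ∏ j, f' j) (SetLike.mul_mem_graded hr hprod)) ?_
    · zify
      rw [hσ, hm]
      push_cast
      rw [← Finset.mul_sum]
      linarith
    · rw [pow_succ, map_mul, mul_right_comm, algebraMap_pow_mul_mk, map_mul]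

end AInvariant

/-! ### Gorenstein duality and the length of a colon quotient. -/

theorem sum_range_le_two_mul {g h : ℕ → ℕ} {S : ℕ} (h₁ : ∀ n ≤ S, g n ≤ h n)
    (h₂ : ∀ n ≤ S, g n ≤ h (S - n)) :
    ∑ n ∈ Finset.range (S + 1), g n ≤ 2 * ∑ n ∈ Finset.range (S / 2 + 1), h n := by
  let F : ℕ → ℕ := fun n => if n ≤ S / 2 then h n else 0
  have hF : ∑ n ∈ Finset.range (S + 1), F n ≤ ∑ n ∈ Finset.range (S / 2 + 1), h n := by
    rw [← Finset.sum_filter]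
    refine Finset.sum_le_sum_of_subset fun n hn => ?_
    simp only [Finset.mem_filter, Finset.mem_range] at hn ⊢
    lia
  have hle : ∀ n ∈ Finset.range (S + 1), g n ≤ F n + F (S - n) := fun n hn => by
    have hn' : n ≤ S := by simpa [Nat.lt_succ_iff] using hn
    by_cases h3 : n ≤ S / 2
    · have : F n = h n := if_pos h3
      exact (h₁ n hn').trans (by lia)
    · have : F (S - n) = h (S - n) := if_pos (by lia)
      exact (h₂ n hn').trans (by lia)
  have hrefl := Finset.sum_range_reflect F (S + 1)
  simp only [Nat.add_sub_cancel] at hrefl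
  have := Finset.sum_le_sum hle
  rw [Finset.sum_add_distrib, hrefl] at this
  lia

section Pairing

variable {k : Type v} {R : Type u} [Field k] [CommRing R] [Algebra k R]
variable {𝒜 : ℕ → Submodule k R} [GradedAlgebra 𝒜]

variable (𝒜) in
/-- The elements of `R ⧸ I` that are killed by `R_+` form a space of dimension at most `1`. -/
def HasSimpleSocle (I : Ideal R) : Prop :=
  ∀ s ∉ I, (∀ y ∈ irr 𝒜, y * s ∈ I) → ∀ v, (∀ y ∈ irr 𝒜, y * v ∈ I) →
    ∃ c : k, v - algebraMap k R c * s ∈ I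

theorem IsHomogeneousParameters.hasSimpleSocle [IsNoetherianRing R] [Nontrivial R] {d : ℕ}
    {b : Fin d → ℕ} {f : Fin d → R} (hzero : 𝒜 0 = 1) (hgor : IsLocallyGorenstein 𝒜)
    (hf : IsHomogeneousParameters 𝒜 b f) : HasSimpleSocle 𝒜 (Ideal.span (Set.range f)) := by
  have hprime := (irr_isMaximal 𝒜 hzero).isPrime
  have h := (hf.isRegularIdeal_span_image hzero hgor Finset.univ).1
  rw [Finset.coe_univ, Set.image_univ] at h
  exact fun s hs hs' => (h.socle hzero hgor hs hs').2

theorem mul_mem_of_mem_irr {I : Ideal R} {v : R}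
    (h : ∀ n, 0 < n → ∀ y ∈ 𝒜 n, y * v ∈ I) : ∀ y ∈ irr 𝒜, y * v ∈ I := by
  intro y hy
  have h1 : y ∈ Submodule.colon I {v} := by
    refine mem_of_forall_decompose_mem 𝒜 fun n => Submodule.mem_colon_singleton.2 ?_
    rcases Nat.eq_zero_or_pos n with rfl | hn
    · rw [(mem_irr_iff 𝒜).1 hy, zero_smul]
      exact zero_mem _
    · exact h n hn _ (SetLike.coe_mem _)
  exact Submodule.mem_colon_singleton.1 h1

theorem IsTopDegree.mul_mem {I : Ideal R} {σ : ℕ} (h : IsTopDegree 𝒜 I σ) {w : R}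
    (hw : w ∈ 𝒜 σ) : ∀ y ∈ irr 𝒜, y * w ∈ I :=
  mul_mem_of_mem_irr fun n hn y hy => h.2 (n + σ) (by lia) _ (SetLike.mul_mem_graded hy hw)

/-- The pairing into the top degree is nondegenerate: a multiple x y ∉ I with y of maximal degree is
killed by R_+, hence is a socle element, and the simple socle sits in degree σ. -/
theorem exists_mul_notMem {I : Ideal R} (hI : I.IsHomogeneous 𝒜) {σ : ℕ} (h : IsTopDegree 𝒜 I σ)
    (hs : HasSimpleSocle 𝒜 I) {n : ℕ} {x : R} (hx : x ∈ 𝒜 n) (hxI : x ∉ I) :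
    n ≤ σ ∧ ∃ y ∈ 𝒜 (σ - n), x * y ∉ I := by
  obtain ⟨⟨w, hw, hwI⟩, htop⟩ := id h
  have hbd : ∀ m, (∃ y ∈ 𝒜 m, x * y ∉ I) → n + m ≤ σ := by
    rintro m ⟨y, hy, hxy⟩
    by_contra! hlt
    exact hxy (htop _ hlt _ (SetLike.mul_mem_graded hx hy))
  have h0 : ∃ y ∈ 𝒜 0, x * y ∉ I := ⟨1, SetLike.GradedOne.one_mem, by rwa [mul_one]⟩
  classical
  have hspec := Nat.findGreatest_spec (P := fun m => ∃ y ∈ 𝒜 m, x * y ∉ I) (Nat.zero_le σ) h0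
  set m := Nat.findGreatest (fun m => ∃ y ∈ 𝒜 m, x * y ∉ I) σ with hm
  have hle := hbd m hspec
  obtain ⟨y, hy, hxy⟩ := hspec
  have hv : ∀ z ∈ irr 𝒜, z * (x * y) ∈ I := mul_mem_of_mem_irr fun j hj z hz => by
    by_contra hcon
    have h1 : ∃ y ∈ 𝒜 (j + m), x * y ∉ I :=
      ⟨z * y, SetLike.mul_mem_graded hz hy, by rwa [mul_left_comm]⟩
    have h2 := Nat.le_findGreatest (P := fun m => ∃ y ∈ 𝒜 m, x * y ∉ I)
      (by have := hbd _ h1; lia : j + m ≤ σ) h1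
    lia
  suffices hnm : n + m = σ by
    refine ⟨by lia, y, ?_, hxy⟩
    rwa [show σ - n = m by lia]
  by_contra hne
  obtain ⟨c, hc⟩ := hs w hwI (h.mul_mem hw) _ hv
  refine hxy ?_
  have h3 := hI (n + m) hc
  rwa [← Algebra.smul_def, DirectSum.decompose_sub, DirectSum.sub_apply, AddSubgroupClass.coe_sub,
    DirectSum.decompose_of_mem_same 𝒜 (SetLike.mul_mem_graded hx hy),
    DirectSum.decompose_of_mem_ne 𝒜 (Submodule.smul_mem _ c hw) (Ne.symm hne), sub_zero] at h3

theorem exists_functional {I : Ideal R} {σ : ℕ} (h : IsTopDegree 𝒜 I σ)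
    (hs : HasSimpleSocle 𝒜 I) :
    ∃ l : R →ₗ[k] k, (∀ x ∈ I, l x = 0) ∧ ∀ x ∈ 𝒜 σ, x ∉ I → l x ≠ 0 := by
  obtain ⟨w, hw, hwI⟩ := h.1
  obtain ⟨l, hl, hle⟩ := Submodule.exists_le_ker_of_notMem (p := I.restrictScalars k) (v := w) hwI
  refine ⟨l, fun x hx => hle hx, fun x hx hxI hlx => hl ?_⟩
  obtain ⟨c, hc⟩ := hs x hxI (h.mul_mem hx) w (h.mul_mem hw)
  have h1 : l (w - algebraMap k R c * x) = 0 := hle hc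
  rwa [← Algebra.smul_def, map_sub, map_smul, hlx, smul_zero, sub_zero] at h1

variable [IsNoetherianRing R]

theorem hilb_le_finrank (hzero : 𝒜 0 = 1) (J : Ideal R) (n : ℕ) :
    hilb 𝒜 J n ≤ Module.finrank k (𝒜 n) := by
  have := finite_component 𝒜 hzero n
  exact Submodule.finrank_map_le _ _

/-- The map x ↦ l(x v ·), with l a functional detecting the socle of R/I, embeds (R/(I : v))_n in
the dual of R_(σ-τ-n). -/
theorem hilb_colon_le_finrank (hzero : 𝒜 0 = 1) {I : Ideal R} (hI : I.IsHomogeneous 𝒜) {σ τ : ℕ}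
    (h : IsTopDegree 𝒜 I σ) (hs : HasSimpleSocle 𝒜 I) {v : R} (hv : v ∈ 𝒜 τ) (n : ℕ) :
    hilb 𝒜 (Submodule.colon I {v}) n ≤ Module.finrank k (𝒜 (σ - τ - n)) := by
  have := finite_component 𝒜 hzero (σ - τ - n)
  have := finite_component 𝒜 hzero n
  obtain ⟨l, hl, hl'⟩ := exists_functional h hs
  let B : R →ₗ[k] (𝒜 (σ - τ - n) →ₗ[k] k) :=
    ((LinearMap.compRight k l).comp (LinearMap.mul k R)).compl₁₂ (LinearMap.mulRight k v)
      (𝒜 (σ - τ - n)).subtype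
  have hB : ∀ x y, B x y = l (x * v * y) := fun x y => rfl
  have hker : ∀ x ∈ Submodule.colon I {v}, B x = 0 := fun x hx => LinearMap.ext fun y =>
    hl _ (I.mul_mem_right _ (Submodule.mem_colon_singleton.1 hx))
  let B' : (R ⧸ Submodule.colon I {v}) →ₗ[k] (𝒜 (σ - τ - n) →ₗ[k] k) :=
    Submodule.liftQ ((Submodule.colon I {v}).restrictScalars k) B hker
  have hB' : ∀ x, B' (Ideal.Quotient.mk _ x) = B x := fun x => rfl
  rw [← Subspace.dual_finrank_eq (K := k) (V := 𝒜 (σ - τ - n))]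
  refine LinearMap.finrank_le_finrank_of_injective
    (f := B'.comp (quotComponent 𝒜 (Submodule.colon I {v}) n).subtype) ?_
  rw [injective_iff_map_eq_zero]
  rintro ⟨_, x, hx, rfl⟩ h0
  refine Subtype.ext (Ideal.Quotient.eq_zero_iff_mem.2 (Submodule.mem_colon_singleton.2 ?_))
  by_contra hxv
  obtain ⟨hle, y, hy, hy'⟩ := exists_mul_notMem hI h hs (SetLike.mul_mem_graded hx hv) hxv
  refine hl' _ ?_ hy' ((hB x ⟨y, ?_⟩).symm.trans (DFunLike.congr_fun h0 _))
  · have h1 := SetLike.mul_mem_graded (SetLike.mul_mem_graded hx hv) hy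
    rwa [show n + τ + (σ - (n + τ)) = σ by lia] at h1
  · rwa [show σ - τ - n = σ - (n + τ) by lia]

/-- The components up to degree S span R/J. Their sum need not be direct, so J is not required to be
homogeneous. -/
theorem finite_and_finrank_quotient_le (hzero : 𝒜 0 = 1) {J : Ideal R} {S : ℕ}
    (hJ : ∀ n, S < n → ∀ x ∈ 𝒜 n, x ∈ J) :
    Module.Finite k (R ⧸ J) ∧
      Module.finrank k (R ⧸ J) ≤ ∑ n ∈ Finset.range (S + 1), hilb 𝒜 J n := by
  classical
  have := fun n => finite_quotComponent hzero J n
  let F : (∀ i : Fin (S + 1), quotComponent 𝒜 J i) →ₗ[k] R ⧸ J :=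
    ∑ i : Fin (S + 1), (quotComponent 𝒜 J i).subtype.comp (LinearMap.proj i)
  have hF : Function.Surjective F := by
    intro x
    obtain ⟨r, rfl⟩ := Ideal.Quotient.mk_surjective x
    refine ⟨fun i => ⟨Ideal.Quotient.mk J (DirectSum.decompose 𝒜 r i), _, SetLike.coe_mem _, rfl⟩, ?_⟩
    simp only [F, LinearMap.sum_apply, LinearMap.comp_apply, LinearMap.proj_apply,
      Submodule.subtype_apply]
    rw [Fin.sum_univ_eq_sum_range (fun n => Ideal.Quotient.mk J (DirectSum.decompose 𝒜 r n : R)),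
      ← map_sum, Ideal.Quotient.eq, ← neg_sub, neg_mem_iff]
    nth_rw 1 [← DirectSum.sum_support_decompose 𝒜 r]
    rw [← Ideal.Quotient.eq, map_sum, map_sum]
    have hJ' : ∀ n ∉ Finset.range (S + 1),
        Ideal.Quotient.mk J (DirectSum.decompose 𝒜 r n : R) = 0 := fun n hn =>
      Ideal.Quotient.eq_zero_iff_mem.2 (hJ n (by simpa using hn) _ (SetLike.coe_mem _))
    rw [Finset.sum_subset (Finset.subset_union_left (s₂ := Finset.range (S + 1))),
      ← Finset.sum_subset (Finset.subset_union_right (s₁ := (DirectSum.decompose 𝒜 r).support))]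
    · exact fun n _ hn => hJ' n hn
    · intro n _ hn
      rw [DFinsupp.notMem_support_iff] at hn
      rw [hn, ZeroMemClass.coe_zero, map_zero]
  refine ⟨Module.Finite.of_surjective F hF, ?_⟩
  refine (LinearMap.finrank_le_finrank_of_surjective hF).trans (le_of_eq ?_)
  rw [Module.finrank_pi_fintype]
  exact Fin.sum_univ_eq_sum_range (hilb 𝒜 J) (S + 1)

theorem finite_and_finrank_quotient_colon_le (hzero : 𝒜 0 = 1) {I : Ideal R}
    (hI : I.IsHomogeneous 𝒜) {σ τ : ℕ} (h : IsTopDegree 𝒜 I σ) (hs : HasSimpleSocle 𝒜 I) {v : R}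
    (hv : v ∈ 𝒜 τ) :
    Module.Finite k (R ⧸ Submodule.colon I {v}) ∧
      Module.finrank k (R ⧸ Submodule.colon I {v}) ≤
        2 * ∑ n ∈ Finset.range ((σ - τ) / 2 + 1), Module.finrank k (𝒜 n) := by
  obtain ⟨h1, h2⟩ := finite_and_finrank_quotient_le (J := Submodule.colon I {v}) (S := σ - τ) hzero
    fun n hn x hx => Submodule.mem_colon_singleton.2
      (h.2 (n + τ) (by lia) _ (SetLike.mul_mem_graded hx hv))
  exact ⟨h1, h2.trans (sum_range_le_two_mul (fun n _ => hilb_le_finrank hzero _ n)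
    fun n _ => hilb_colon_le_finrank hzero hI h hs hv n)⟩

end Pairing

/-! ### Free ranks of Frobenius push-forwards. -/

section Frobenius

variable {k : Type v} {R : Type u} [Field k] [PerfectField k] [CommRing R] [Algebra k R]

/-- The identity map. -/
def FrobeniusModule.toRing (R : Type u) [CommRing R] (p e : ℕ) : FrobeniusModule R p e ≃+ R :=
  AddEquiv.refl R

theorem FrobeniusModule.toRing_smul (p e : ℕ) [ExpChar R p] (r : R) (x : FrobeniusModule R p e) :
    toRing R p e (r • x) = r ^ p ^ e * toRing R p e x := rfl

theorem le_finrank_of_isFreeRank [Nontrivial R] (p : ℕ) [ExpChar R p] {d e c : ℕ} {f : Fin d → R}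
    {u : R} (hu : ∀ l : k, algebraMap k R l * u ∈ Ideal.span (Set.range f) → l = 0)
    (h : IsFreeRank R (FrobeniusModule R p e) c)
    [Module.Finite k
      (R ⧸ Submodule.colon (Ideal.span (Set.range fun i => f i ^ p ^ e)) {u ^ p ^ e})] :
    c ≤ Module.finrank k
      (R ⧸ Submodule.colon (Ideal.span (Set.range fun i => f i ^ p ^ e)) {u ^ p ^ e}) := by
  obtain ⟨N, Q, hNQ, ⟨ψ⟩, -⟩ := h
  have hk : ExpChar k p := (algebraMap k R).expChar (algebraMap k R).injective p
  set J := Submodule.colon (Ideal.span (Set.range fun i => f i ^ p ^ e)) {u ^ p ^ e}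
  let T := FrobeniusModule.toRing R p e
  let P : FrobeniusModule R p e →ₗ[R] (Fin c → R) := ψ.toLinearMap.comp (N.projectionOnto Q hNQ)
  have hP : ∀ y : Fin c → R, P (ψ.symm y : N) = y := fun y => by
    simp [P]
  have hT : ∀ X, T X ∈ J → ∀ i, P X i * u ∈ Ideal.span (Set.range f) := by
    intro X hX i
    have h1 : T X * u ^ p ^ e ∈ Ideal.span (Set.range fun i => f i ^ p ^ e) :=
      Submodule.mem_colon_singleton.1 hX
    obtain ⟨a, ha⟩ := Ideal.mem_span_range_iff_exists_fun.1 h1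
    -- The membership X u^q ∈ (f_j^q), read in the module structure of R^(e), where scalars act
    -- through their q-th powers.
    have h2 : u • X = ∑ j, f j • T.symm (a j) := by
      apply T.injective
      rw [map_sum, FrobeniusModule.toRing_smul, mul_comm]
      refine ha.symm.trans (Finset.sum_congr rfl fun j _ => ?_)
      rw [FrobeniusModule.toRing_smul, mul_comm]
      rfl
    have h3 := congrFun (congrArg P h2) i
    rw [map_smul, map_sum, Finset.sum_apply, Pi.smul_apply, smul_eq_mul, mul_comm] at h3
    rw [h3]
    refine Ideal.sum_mem _ fun j _ => ?_
    rw [map_smul, Pi.smul_apply, smul_eq_mul]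
    exact Ideal.mul_mem_right _ _ (Ideal.subset_span ⟨j, rfl⟩)
  let F : (Fin c → k) →ₗ[k] R ⧸ J := ∑ i, (LinearMap.toSpanSingleton k (R ⧸ J)
    (Ideal.Quotient.mk J (T (ψ.symm (Pi.single i 1) : N)))).comp (LinearMap.proj i)
  have hF : Function.Injective F := by
    rw [injective_iff_map_eq_zero]
    intro μ hμ
    -- Perfectness of k: with q-th roots of the coefficients, a k-combination in R becomes an
    -- R-combination in R^(e), to which P applies.
    choose l hl using fun i => (bijective_iterateFrobenius k p (n := e)).2 (μ i)
    simp only [iterateFrobenius_def] at hl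
    have h1 : F μ = Ideal.Quotient.mk J (T (ψ.symm (fun i => algebraMap k R (l i)) : N)) := by
      have h2 : (fun i => algebraMap k R (l i)) =
          ∑ i, algebraMap k R (l i) • (Pi.single i 1 : Fin c → R) := by
        rw [← pi_eq_sum_univ' (fun i => algebraMap k R (l i))]
      rw [h2, map_sum, AddSubmonoidClass.coe_finsetSum, map_sum, map_sum]
      simp only [F, LinearMap.sum_apply]
      refine Finset.sum_congr rfl fun i _ => ?_
      rw [map_smul, Submodule.coe_smul, FrobeniusModule.toRing_smul, ← map_pow, hl,
        ← Algebra.smul_def]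
      rfl
    rw [h1, Ideal.Quotient.eq_zero_iff_mem] at hμ
    funext i
    have h4 := hT _ hμ i
    rw [hP] at h4
    rw [← hl i, hu (l i) h4, zero_pow (pow_ne_zero _ (expChar_ne_zero R p)), Pi.zero_apply]
  simpa using LinearMap.finrank_le_finrank_of_injective hF

end Frobenius

/-! ### The bound and its limit. -/

section Bound

variable {k : Type v} {R : Type u} [Field k] [PerfectField k] [CommRing R] [Algebra k R]
variable [IsNoetherianRing R] [Nontrivial R]
variable {𝒜 : ℕ → Submodule k R} [GradedAlgebra 𝒜] {d : ℕ} {b : Fin d → ℕ} {f : Fin d → R}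

theorem freeRank_le (p : ℕ) [ExpChar R p] (hzero : 𝒜 0 = 1) (hgor : IsLocallyGorenstein 𝒜)
    (hf : IsHomogeneousParameters 𝒜 b f) {a : ℤ} {e' : ℝ} (he' : 0 ≤ e')
    (ha : ∀ (b' : Fin d → ℕ) (f' : Fin d → R), IsHomogeneousParameters 𝒜 b' f' →
      ∃ σ : ℕ, (σ : ℤ) = a + ∑ i, (b' i : ℤ) ∧ IsTopDegree 𝒜 (Ideal.span (Set.range f')) σ)
    (hN : ∀ N : ℕ, ∑ n ∈ Finset.range (N + 1), (Module.finrank k (𝒜 n) : ℝ) ≤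
        e' / d ! * (N + ∑ i, (b i : ℝ)) ^ d) {e c : ℕ}
    (hc : IsFreeRank R (FrobeniusModule R p e) c) :
    (c : ℝ) ≤ 2 * (e' / d ! *
      (max (-(a : ℝ)) 0 * (p : ℝ) ^ e / 2 + ∑ i, (b i : ℝ)) ^ d) := by
  have hq : 0 < p ^ e := pow_pos (expChar_pos R p) e
  have hg := hf.pow (e := fun _ => p ^ e) fun _ => hq
  obtain ⟨σ, hσ, ⟨u, hu, huI⟩, -⟩ := ha b f hf
  obtain ⟨σ', hσ', htop⟩ := ha _ _ hg
  have hu0 : ∀ l : k, algebraMap k R l * u ∈ Ideal.span (Set.range f) → l = 0 := by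
    intro l hl
    by_contra hl0
    exact huI ((Ideal.unit_mul_mem_iff_mem _ ((Ne.isUnit hl0).map (algebraMap k R))).1 hl)
  obtain ⟨h1, h2⟩ := finite_and_finrank_quotient_colon_le hzero hg.isHomogeneous htop
    (hg.hasSimpleSocle hzero hgor) (SetLike.pow_mem_graded (p ^ e) hu)
  have h3 : (c : ℝ) ≤ 2 * ∑ n ∈ Finset.range ((σ' - p ^ e * σ) / 2 + 1),
      (Module.finrank k (𝒜 n) : ℝ) := by
    exact_mod_cast (le_finrank_of_isFreeRank p hu0 hc).trans h2
  -- Without truncation the difference is (q - 1)(-a); the natural subtraction returns 0 when this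
  -- is negative.
  have hS : ((σ' - p ^ e * σ : ℕ) : ℝ) ≤ max (-(a : ℝ)) 0 * (p : ℝ) ^ e := by
    rcases le_total σ' (p ^ e * σ) with hle | hle
    · rw [Nat.sub_eq_zero_of_le hle, Nat.cast_zero]
      positivity
    · have hq1 : (1 : ℝ) ≤ (p : ℝ) ^ e := by exact_mod_cast hq
      have h4 : (σ : ℝ) = a + ∑ i, (b i : ℝ) := by exact_mod_cast hσ
      have h5 : (σ' : ℝ) = a + (p : ℝ) ^ e * ∑ i, (b i : ℝ) := by
        rw [Finset.mul_sum]
        exact_mod_cast hσ'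
      rw [Nat.cast_sub hle]
      push_cast
      rw [h4, h5]
      nlinarith [le_max_left (-(a : ℝ)) 0, le_max_right (-(a : ℝ)) 0]
  have hhalf : (((σ' - p ^ e * σ) / 2 : ℕ) : ℝ) ≤ max (-(a : ℝ)) 0 * (p : ℝ) ^ e / 2 :=
    Nat.cast_div_le.trans (by push_cast; linarith)
  refine h3.trans (mul_le_mul_of_nonneg_left ((hN _).trans ?_) zero_le_two)
  gcongr

end Bound

/-- Only the leading term 2 (C/d!)(m/2)^d survives. The exponent d - 1 is an integer, so for d = 0
the power is 1/2. -/
theorem tendsto_bound {p : ℕ} (hp : 1 < p) (C m B : ℝ) (d : ℕ) :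
    Tendsto (fun e : ℕ => 2 * (C / d ! * (m * (p : ℝ) ^ e / 2 + B) ^ d) / ((p : ℝ) ^ e) ^ d)
      atTop (𝓝 (m ^ d * C / ((2 : ℝ) ^ ((d : ℤ) - 1) * (d ! : ℝ)))) := by
  have hp' : (1 : ℝ) < p := by exact_mod_cast hp
  have hpos : ∀ e : ℕ, (0 : ℝ) < (p : ℝ) ^ e := fun e => pow_pos (by linarith) e
  have h1 : Tendsto (fun e : ℕ => B / (p : ℝ) ^ e) atTop (𝓝 0) :=
    tendsto_const_nhds.div_atTop (tendsto_pow_atTop_atTop_of_one_lt hp')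
  have h2 : Tendsto (fun e : ℕ => 2 * (C / d ! * (m / 2 + B / (p : ℝ) ^ e) ^ d)) atTop
      (𝓝 (2 * (C / d ! * (m / 2 + 0) ^ d))) :=
    (((h1.const_add _).pow d).const_mul _).const_mul _
  have h3 : 2 * (C / d ! * (m / 2 + 0) ^ d) = m ^ d * C / ((2 : ℝ) ^ ((d : ℤ) - 1) * (d ! : ℝ)) := by
    rw [add_zero, zpow_sub_one₀ two_ne_zero, zpow_natCast, div_pow]
    field_simp
  rw [← h3]
  refine h2.congr fun e => ?_
  rw [mul_div_assoc, mul_div_assoc, ← div_pow, add_div, mul_div_right_comm,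
    mul_div_assoc (m / 2), div_self (hpos e).ne', mul_one]

end GradedFSignature

theorem theorem5p4 {k : Type v} {R : Type u} [Field k] [PerfectField k] [CommRing R] [Algebra k R]
    (p : ℕ) [Fact p.Prime] [CharP R p]
    (𝒜 : ℕ → Submodule k R) [GradedAlgebra 𝒜]
    (hzero : 𝒜 0 = 1)
    (hred : IsReduced R)
    (hfin : (frobenius R p).Finite)
    (hgor : GradedFSignature.IsGorenstein R)
    (d : ℕ) (hd : ringKrullDim R = d) :
    ∃ (a : ℤ) (e' : ℝ),
      GradedFSignature.IsAInvariant 𝒜 d a ∧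
      Tendsto (fun t : ℝ => (1 - t) ^ d * GradedFSignature.poincareSeries 𝒜 t)
        (𝓝[<] 1) (𝓝 e') ∧
      (∀ c : ℕ → ℕ, GradedFSignature.IsFreeRankSequence R p c →
        limsup (fun e : ℕ => (((c e : ℝ) / ((p : ℝ) ^ e) ^ d : ℝ) : EReal)) atTop ≤
          (((max (-(a : ℝ)) 0) ^ d * e' / ((2 : ℝ) ^ ((d : ℤ) - 1) * (d ! : ℝ)) : ℝ) : EReal)) ∧
      (∀ s : ℝ, GradedFSignature.IsFSignature R p d s →
        s ≤ (max (-(a : ℝ)) 0) ^ d * e' / ((2 : ℝ) ^ ((d : ℤ) - 1) * (d ! : ℝ))) := by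
  have hprime : p.Prime := Fact.out
  have : IsNoetherianRing R := hgor.1
  have : Nontrivial R := CharP.nontrivial_of_char_ne_one (v := p) hprime.ne_one
  have hloc : GradedFSignature.IsLocallyGorenstein 𝒜 := hgor.2 _
  obtain ⟨b, f, hf⟩ := GradedFSignature.IsHomogeneousParameters.exists hzero hloc hd
  obtain ⟨a, e', he', ha, hlim, hN⟩ := GradedFSignature.exists_aInvariant_data hzero hloc hf
  have hbound : ∀ c : ℕ → ℕ, GradedFSignature.IsFreeRankSequence R p c → ∀ᶠ e : ℕ in atTop,
      (c e : ℝ) / ((p : ℝ) ^ e) ^ d ≤ 2 * (e' / d ! *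
        (max (-(a : ℝ)) 0 * (p : ℝ) ^ e / 2 + ∑ i, (b i : ℝ)) ^ d) / ((p : ℝ) ^ e) ^ d := by
    intro c hc
    filter_upwards [eventually_gt_atTop 0] with e he
    exact div_le_div_of_nonneg_right
      (GradedFSignature.freeRank_le p hzero hloc hf he' ha hN (hc e he)) (by positivity)
  have htend := GradedFSignature.tendsto_bound hprime.one_lt e' (max (-(a : ℝ)) 0)
    (∑ i, (b i : ℝ)) d
  refine ⟨a, e', GradedFSignature.isAInvariant_of_isTopDegree hzero hloc hf ha, hlim,
    fun c hc => ?_, fun s ⟨c, hc, hs⟩ => le_of_tendsto_of_tendsto hs htend (hbound c hc)⟩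
  -- Taking the limsup in `EReal` removes any boundedness condition.
  refine (limsup_le_limsup ?_).trans (continuous_coe_real_ereal.tendsto _ |>.comp htend).limsup_eq.le
  filter_upwards [hbound c hc] with e he
  exact EReal.coe_le_coe_iff.2 he
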